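/- **Setting.** Let $\mathcal G=\langle V,E,w\rangle$ be a mean-payoff poorman game: $V$ is a finite set of vertices, every vertex has at least one outgoing edge, and $w:V\to\mathbb Q$. Player 1 (Max) and Player 2 (Min) start with budgets $B_1,B_2\ge 0$, $B_1+B_2>0$; the ratio of Player 1 is $B_1/(B_1+B_2)$. In each round both players simultaneously choose a non-negative bid not exceeding their current budget and a neighbor of the current vertex; the higher bidder pays his bid to the bank, the budget of the other player does not change, and the token moves to the neighbor chosen by the higher bidder. Draws are resolved by an arbitrary fixed mechanism. The payoff of an infinite path $v_1,v_2,\ldots$ is $\liminf_{n\to\infty}\frac1n\sum_{1\le j<n}w(v_j)$, and Max wins iff it is non-negative. For an objective of Player 1, a threshold ratio in $v$ is a $t\in[0,1]$ such that, when the game starts in $v$, Player 1 has a winning strategy whenever his initial ratio exceeds $t$, and Player 2 has a winning strategy whenever the initial ratio of Player 1 is less than $t$. **The corresponding generalized reachability game.** Let $S_1,\ldots,S_k$ be the bottom strongly-connected components of $\langle V,E\rangle$ and let $\mathcal G_i$ be the restriction of $\mathcal G$ to $S_i$. For $r\in[0,1]$ let $\mathrm{MP}^r(\mathcal G_i)$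 be the maximal payoff that Max can guarantee in $\mathcal G_i$ with every initial ratio above $r$ (with initial ratio $1$ if $r=1$); it does not depend on the initial vertex. Let $r_i$ be the $r\in[0,1]$ with $\mathrm{MP}^r(\mathcal G_i)=0$ if there is one (the least one if there are several); otherwise let $r_i=0$ if $\mathrm{MP}^r(\mathcal G_i)>0$ for every $r\in[0,1]$, and $r_i=1$ if $\mathrm{MP}^r(\mathcal G_i)<0$ for every $r\in[0,1]$. The game $\mathcal G'$ is the poorman game obtained from $\mathcal G$ by contracting every $S_i$ to a single vertex $u_i$ (which keeps only a self-loop); Player 1 wins a play of $\mathcal G'$ iff it visits some $u_i$ and, when it first does so, his ratio is at least $r_i$. **Theorem 5.** For every vertex $v\in V$ there is a threshold ratio in $v$ in the mean-payoff poorman game $\mathcal G$, and it coincides with the threshold ratio in $\mathcal G'$ of the vertex that represents $v$ (which is $v$ itself if $v$ lies in no $S_i$, and $u_i$ if $v\in S_i$): a number $t$ is a threshold ratio in $v$ in $\mathcal G$ if and only if it is a threshold ratio of that vertex in $\mathcal G'$. This holds whatever mechanisms resolve the draws in $\mathcal G$, in the games $\mathcal G_i$ and in $\mathcal G'$. -/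

import Mathlib

open Filter Set

namespace Poorman

/-! Arenas and the poorman bidding mechanism. -/

inductive Player where
  | one
  | two
  deriving DecidableEq

/-- A directed graph in which every vertex has an outgoing edge (so that plays are infinite). -/
structure Arena (V : Type*) where
  Edge : V → V → Prop
  exists_edge : ∀ v, ∃ u, Edge v u

/-- An action: a bid, and the vertex to move to upon winning the bidding. -/
structure Action (V : Type*) where
  bid : ℝ
  target : V

/-- A history: an initial vertex, followed by rounds that record the winning bid, the winner of
the bidding and the vertex to which the winner moved the token. -/
inductive History (V : Type*) where
  | start (v : V) : History V
  | step (h : History V) (bid : ℝ) (winner : Player) (v : V) : History V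

/-- The vertex on which the token is placed. -/
def History.current {V : Type*} : History V → V
  | .start v => v
  | .step _ _ _ v => v

/-- The sum of the winning bids of a player. -/
def History.spent {V : Type*} (p : Player) : History V → ℝ
  | .start _ => 0
  | .step h b q _ => h.spent p + if q = p then b else 0

/-- The budget that is left to a player after a history: the winner of a bidding pays the bank,
and the budget of the loser does not change. -/
def History.budget {V : Type*} (h : History V) (B : Player → ℝ) (p : Player) : ℝ :=
  B p - h.spent p

/-- Initial budgets: non-negative, with positive sum. -/
def IsBudget (B : Player → ℝ) : Prop :=
  (∀ p, 0 ≤ B p) ∧ 0 < B .one + B .two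

/-- The ratio of Player 1. -/
noncomputable def ratio (B : Player → ℝ) : ℝ :=
  B .one / (B .one + B .two)

/-- After `h`, Player `p` may bid at most his available budget, and may move along an edge. -/
def Arena.LegalAction {V : Type*} (A : Arena V) (B : Player → ℝ) (h : History V) (p : Player)
    (a : Action V) : Prop :=
  0 ≤ a.bid ∧ a.bid ≤ h.budget B p ∧ A.Edge h.current a.target

/-- The histories that can arise from `v` with initial budgets `B`. -/
inductive Arena.IsHistory {V : Type*} (A : Arena V) (B : Player → ℝ) (v : V) :
    History V → Prop where
  | start : A.IsHistory B v (.start v)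
  | step (h : History V) (p : Player) (a : Action V) :
      A.IsHistory B v h → A.LegalAction B h p a →
      A.IsHistory B v (.step h a.bid p a.target)

abbrev Strategy (V : Type*) := History V → Action V

/-- `f` is a strategy of Player `p` in the game that starts in `v` with initial budgets `B`. -/
def Arena.IsStrategy {V : Type*} (A : Arena V) (B : Player → ℝ) (v : V) (p : Player)
    (f : Strategy V) : Prop :=
  ∀ h, A.IsHistory B v h → A.LegalAction B h p (f h)

/-- A mechanism that resolves draws: it names the winner of a bidding in which both bids are
equal, and may depend on the history and on the two actions. -/
abbrev TieRule (V : Type*) := History V → Action V → Action V → Player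

/-- The winner of the bidding after `h` when the players choose the actions `a₁` and `a₂`. -/
noncomputable def bidWinner {V : Type*} (tie : TieRule V) (h : History V) (a₁ a₂ : Action V) :
    Player :=
  if a₂.bid < a₁.bid then .one
  else if a₁.bid < a₂.bid then .two
  else tie h a₁ a₂

/-- One round of the game. -/
noncomputable def nextHistory {V : Type*} (tie : TieRule V) (f g : Strategy V) (h : History V) :
    History V :=
  match bidWinner tie h (f h) (g h) with
  | .one => .step h (f h).bid .one (f h).target
  | .two => .step h (g h).bid .two (g h).target

/-- The play that is determined by an initial vertex, a strategy `f` of Player 1 and a strategy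
`g` of Player 2, as the sequence of its finite prefixes. -/
noncomputable def play {V : Type*} (tie : TieRule V) (f g : Strategy V) (v : V) : ℕ → History V
  | 0 => .start v
  | n + 1 => nextHistory tie f g (play tie f g v n)

/-- What an objective may refer to at a time point: the position of the token and the budgets. -/
structure Config (V : Type*) where
  vertex : V
  budget : Player → ℝ

noncomputable def trace {V : Type*} (tie : TieRule V) (B : Player → ℝ) (f g : Strategy V) (v : V)
    (n : ℕ) : Config V :=
  ⟨(play tie f g v n).current, (play tie f g v n).budget B⟩

/-- An objective of Player 1. -/
abbrev Objective (V : Type*) := Set (ℕ → Config V)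

/-- Player 1 has a winning strategy from `v` with initial budgets `B`. -/
def Arena.Wins₁ {V : Type*} (A : Arena V) (tie : TieRule V) (O : Objective V) (v : V)
    (B : Player → ℝ) : Prop :=
  ∃ f, A.IsStrategy B v .one f ∧ ∀ g, A.IsStrategy B v .two g → trace tie B f g v ∈ O

/-- Player 2 has a winning strategy from `v` with initial budgets `B`. -/
def Arena.Wins₂ {V : Type*} (A : Arena V) (tie : TieRule V) (O : Objective V) (v : V)
    (B : Player → ℝ) : Prop :=
  ∃ g, A.IsStrategy B v .two g ∧ ∀ f, A.IsStrategy B v .one f → trace tie B f g v ∉ O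

/-- `t` is the threshold ratio in `v`. -/
def Arena.IsThreshold {V : Type*} (A : Arena V) (tie : TieRule V) (O : Objective V) (v : V)
    (t : ℝ) : Prop :=
  t ∈ Icc (0 : ℝ) 1 ∧
    ∀ B, IsBudget B →
      (t < ratio B → A.Wins₁ tie O v B) ∧ (ratio B < t → A.Wins₂ tie O v B)

/-! Mean-payoff games. Player 1 is Max and Player 2 is Min. -/

structure MeanPayoffGame (V : Type*) extends Arena V where
  weight : V → ℚ

/-- The energy of the prefix of length `n` (that is, with `n` vertices) of a path; the last
vertex of the prefix does not contribute. -/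
def energy {V : Type*} (w : V → ℚ) (π : ℕ → V) (n : ℕ) : ℝ :=
  ∑ j ∈ Finset.range (n - 1), (w (π j) : ℝ)

noncomputable def payoff {V : Type*} (w : V → ℚ) (π : ℕ → V) : ℝ :=
  liminf (fun n : ℕ => energy w π n / (n : ℝ)) atTop

/-- The payoff is at least `c`. -/
def payoffAtLeast {V : Type*} (w : V → ℚ) (c : ℝ) : Objective V :=
  {σ | c ≤ payoff w fun n => (σ n).vertex}

/-- `t` is the threshold ratio in `v` of the mean-payoff game: Max wins a path if its payoff is
non-negative. -/
def MeanPayoffGame.IsThreshold {V : Type*} (G : MeanPayoffGame V) (tie : TieRule V) (v : V)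
    (t : ℝ) : Prop :=
  G.toArena.IsThreshold tie (payoffAtLeast G.weight 0) v t

/-- The mean-payoff value in `v` with respect to `r`: the maximal payoff that Max can guarantee
with every initial ratio above `r` (for `r = 1`, with the initial ratio `1`). -/
noncomputable def MeanPayoffGame.valueAt {V : Type*} (G : MeanPayoffGame V) (tie : TieRule V)
    (r : ℝ) (v : V) : ℝ :=
  sSup {c : ℝ | ∀ B, IsBudget B → (r < ratio B ∨ ratio B = 1) →
    G.toArena.Wins₁ tie (payoffAtLeast G.weight c) v B}

/-- The value of a strongly-connected game with respect to `r`. In such a game the value does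
not depend on the initial vertex, so the infimum is over equal numbers. -/
noncomputable def MeanPayoffGame.value {V : Type*} (G : MeanPayoffGame V) (tie : TieRule V)
    (r : ℝ) : ℝ :=
  ⨅ v, G.valueAt tie r v

open Classical in
/-- The ratio of a strongly-connected game: the `r` for which the value is `0`, and, if there is
none, `0` if all values are positive and `1` if all are negative. The values increase strictly
with `r` unless all cycles have the same mean weight, so the infimum only matters if that mean is
`0`; then the value is `0` for every `r`, Max always wins, and the ratio is `0`. -/
noncomputable def MeanPayoffGame.sccRatio {V : Type*} (G : MeanPayoffGame V) (tie : TieRule V) :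
    ℝ :=
  if ∃ r ∈ Icc (0 : ℝ) 1, G.value tie r = 0 then
    sInf {r | r ∈ Icc (0 : ℝ) 1 ∧ G.value tie r = 0}
  else if ∀ r ∈ Icc (0 : ℝ) 1, 0 < G.value tie r then 0
  else 1

/-! Bottom strongly-connected components, and the corresponding generalized reachability game. -/

/-- `S` is a bottom strongly-connected component: non-empty, left by no edge, and any two of its
vertices are connected by a path. -/
def Arena.IsBSCC {V : Type*} (A : Arena V) (S : Set V) : Prop :=
  S.Nonempty ∧ (∀ v ∈ S, ∀ u, A.Edge v u → u ∈ S) ∧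
    ∀ v ∈ S, ∀ u ∈ S, Relation.ReflTransGen A.Edge v u

abbrev Arena.BSCC {V : Type*} (A : Arena V) := {S : Set V // A.IsBSCC S}

/-- The game on a BSCC, with the restricted edges and weights. -/
def MeanPayoffGame.restrict {V : Type*} (G : MeanPayoffGame V) (S : G.toArena.BSCC) :
    MeanPayoffGame S.1 where
  Edge v u := G.Edge v u
  exists_edge v := by
    obtain ⟨u, hu⟩ := G.exists_edge v
    exact ⟨⟨u, S.2.2.1 v v.2 u hu⟩, hu⟩
  weight v := G.weight v

/-- The vertices of the corresponding reachability game: the vertices outside all BSCCs, and one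
vertex for each BSCC. -/
abbrev Arena.Contracted {V : Type*} (A : Arena V) :=
  {v : V // ¬ ∃ S, A.IsBSCC S ∧ v ∈ S} ⊕ A.BSCC

open Classical in
/-- The vertex of the contracted graph that stands for `v`. -/
noncomputable def Arena.contract {V : Type*} (A : Arena V) (v : V) : A.Contracted :=
  if h : ∃ S, A.IsBSCC S ∧ v ∈ S then .inr ⟨h.choose, h.choose_spec.1⟩ else .inl ⟨v, h⟩

/-- The contracted graph. The vertex of a BSCC keeps only the self-loop. -/
noncomputable def Arena.contracted {V : Type*} (A : Arena V) : Arena A.Contracted where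
  Edge x y :=
    match x with
    | .inl v => ∃ u, A.Edge v u ∧ A.contract u = y
    | .inr S => y = .inr S
  exists_edge x := by
    match x with
    | .inl v =>
      obtain ⟨u, hu⟩ := A.exists_edge v
      exact ⟨A.contract u, u, hu, rfl⟩
    | .inr S => exact ⟨.inr S, rfl⟩

/-- The generalized reachability objective: the token reaches the vertex of some BSCC `S`, and
when it does (at the first such time point) the ratio of Player 1 is at least `ρ S`. -/
def Arena.reachWithRatio {V : Type*} (A : Arena V) (ρ : A.BSCC → ℝ) : Objective A.Contracted :=
  {σ | ∃ n, ∃ S : A.BSCC, (σ n).vertex = .inr S ∧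
    (∀ m < n, ∀ T : A.BSCC, (σ m).vertex ≠ .inr T) ∧ ρ S ≤ ratio (σ n).budget}

/-- `t` is the threshold ratio in `x` of the generalized reachability game that corresponds to
`G`; `tieS` resolves the draws in the games on the BSCCs, in which the required ratios are
determined. -/
def MeanPayoffGame.IsReachThreshold {V : Type*} (G : MeanPayoffGame V)
    (tieS : ∀ S : G.toArena.BSCC, TieRule S.1) (tie : TieRule G.toArena.Contracted)
    (x : G.toArena.Contracted) (t : ℝ) : Prop :=
  G.toArena.contracted.IsThreshold tie
    (G.toArena.reachWithRatio fun S => (G.restrict S).sccRatio (tieS S)) x t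

end Poorman

namespace Poorman

variable {V : Type*}

/-! Positional strategies, and the plays that a player sees when he uses one. -/

/-! One function `T` on the contracted graph serves both games. Outside the targets it solves T = T⁺
/ (1 - T⁻ + T⁺), where T⁺ and T⁻ are the greatest and least values at the neighbors; at the vertex
of a component it is the component's ratio. Any solution will do, and the Knaster–Tarski theorem
supplies one (`exists_isThresholdEq`). The equations are symmetric under exchanging the players
(`IsThresholdEq.one_sub`), so it suffices that a player whose share exceeds his threshold wins.
Thresholds are unique (`Arena.IsThreshold.eq`), so a common threshold gives the equivalence.

Reaching a component: `T` is raised to a strict bound `U` lying less than ε above it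
(`IsThresholdEq.exists_strictBound`). The player bids so that his excess share - `U` never drops
when he wins and grows by a fixed amount when he loses. Since the excess is at most 1, a component
is reached, and at that point the share exceeds the component's ratio by at least ε/2
(`IsRun.exists_hit`).

Inside a component: let M(p) be the value of the random-turn mean-payoff game in which Max moves
with probability p, with potentials h from its optimality equation. With ratio above q > p, Max bids
in proportion to the potential gap times D = (1-q)x - qy. Then D · exp(aΦ) never decreases, where Φ
is the accumulated weight relative to M(p) plus h (`potential_step`). As D is bounded by his budget,
Φ is bounded below, so the payoff is at least M(p) (`IsRun.sum_bddBelow`, `le_payoff`). Min does the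
same with negated weights.

M exists and is monotone and continuous (`exists_randomTurnValue`), so it equals the poorman value
(`MeanPayoffGame.value_eq`). Hence the component's ratio separates negative from non-negative M
(`MeanPayoffGame.sccRatio_spec`), and the slack ε/2 at entry lets either player choose a suitable p.
-/

def Player.other : Player → Player
  | .one => .two
  | .two => .one

/-- The strategy that bids according to the current vertex, the own budget and the budget of the
other player, and moves to `tgt v` from `v`. Bids are clipped to the available budget. -/
noncomputable def positional (B : Player → ℝ) (p : Player) (bid : V → ℝ → ℝ → ℝ) (tgt : V → V) :
    Strategy V := fun h =>
  ⟨max 0 (min (bid h.current (h.budget B p) (h.budget B p.other)) (h.budget B p)), tgt h.current⟩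

/-- The configurations that can arise when player `p` uses a positional strategy. -/
structure IsRun (A : Arena V) (p : Player) (bid : V → ℝ → ℝ → ℝ) (tgt : V → V)
    (τ : ℕ → Config V) : Prop where
  nonneg : ∀ n q, 0 ≤ (τ n).budget q
  step : ∀ n, ∃ β, β = max 0 (min (bid (τ n).vertex ((τ n).budget p) ((τ n).budget p.other))
      ((τ n).budget p)) ∧
    (((τ (n + 1)).vertex = tgt (τ n).vertex ∧ (τ (n + 1)).budget p = (τ n).budget p - β ∧
        (τ (n + 1)).budget p.other = (τ n).budget p.other) ∨
      (A.Edge (τ n).vertex (τ (n + 1)).vertex ∧ (τ (n + 1)).budget p = (τ n).budget p ∧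
        (τ (n + 1)).budget p.other ≤ (τ n).budget p.other - β))

theorem Arena.IsHistory.budget_nonneg {A : Arena V} {B : Player → ℝ} (hB : IsBudget B) {v : V}
    {h : History V} (hh : A.IsHistory B v h) (p : Player) : 0 ≤ h.budget B p := by
  induction hh with
  | start => simpa [History.budget, History.spent] using hB.1 p
  | step _ q _ _ hl ih =>
    by_cases hq : q = p
    · subst hq
      have := hl.2.1
      simp only [History.budget, History.spent, if_true] at this ⊢
      linarith
    · simpa [History.budget, History.spent, hq] using ih

theorem positional_isStrategy {A : Arena V} {B : Player → ℝ} (hB : IsBudget B) (v : V)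
    (p : Player) (bid : V → ℝ → ℝ → ℝ) {tgt : V → V} (ht : ∀ v, A.Edge v (tgt v)) :
    A.IsStrategy B v p (positional B p bid tgt) := fun _ hh =>
  ⟨le_max_left _ _, max_le (hh.budget_nonneg hB p) (min_le_right _ _), ht _⟩

theorem play_isHistory {A : Arena V} {B : Player → ℝ} {v : V} {f g : Strategy V}
    (hf : A.IsStrategy B v .one f) (hg : A.IsStrategy B v .two g) (tie : TieRule V) (n : ℕ) :
    A.IsHistory B v (play tie f g v n) := by
  induction n with
  | zero => exact .start
  | succ n ih =>
    simp only [play, nextHistory]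
    cases bidWinner tie (play tie f g v n) (f (play tie f g v n)) (g (play tie f g v n)) with
    | one => exact .step _ _ _ ih (hf _ ih)
    | two => exact .step _ _ _ ih (hg _ ih)

theorem le_of_bidWinner_one {tie : TieRule V} {h : History V} {a b : Action V}
    (hw : bidWinner tie h a b = .one) : b.bid ≤ a.bid := by
  by_contra hlt
  push Not at hlt
  simp [bidWinner, hlt, not_lt.mpr hlt.le] at hw

theorem le_of_bidWinner_two {tie : TieRule V} {h : History V} {a b : Action V}
    (hw : bidWinner tie h a b = .two) : a.bid ≤ b.bid := by
  by_contra hlt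
  push Not at hlt
  simp [bidWinner, hlt] at hw

/-- Whoever wins a draw, a winning opponent has paid at least the positional bid. The two
alternatives of `IsRun` therefore cover every tie rule, which no longer appears in the analysis. -/
theorem isRun_trace_one {A : Arena V} {B : Player → ℝ} (hB : IsBudget B) {v : V}
    (tie : TieRule V) (bid : V → ℝ → ℝ → ℝ) {tgt : V → V} (ht : ∀ v, A.Edge v (tgt v))
    {g : Strategy V} (hg : A.IsStrategy B v .two g) :
    IsRun A .one bid tgt (trace tie B (positional B .one bid tgt) g v) := by
  have hf := positional_isStrategy (A := A) hB v .one bid ht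
  refine ⟨fun n q => (play_isHistory hf hg tie n).budget_nonneg hB q, fun n => ⟨_, rfl, ?_⟩⟩
  have hh := play_isHistory hf hg tie n
  simp only [trace, play, nextHistory]
  set h := play tie (positional B .one bid tgt) g v n
  cases hw : bidWinner tie h (positional B .one bid tgt h) (g h) with
  | one =>
    left
    simp only [History.current, History.budget, History.spent, Player.other, positional]
    refine ⟨trivial, ?_, ?_⟩ <;> (simp; try ring)
  | two =>
    right
    have h1 := le_of_bidWinner_two hw
    refine ⟨(hg h hh).2.2, ?_, ?_⟩
    · simp [History.budget, History.spent]
    · simp only [History.current, History.budget, History.spent, Player.other, positional,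
        if_true] at h1 ⊢
      linarith

theorem isRun_trace_two {A : Arena V} {B : Player → ℝ} (hB : IsBudget B) {v : V}
    (tie : TieRule V) (bid : V → ℝ → ℝ → ℝ) {tgt : V → V} (ht : ∀ v, A.Edge v (tgt v))
    {f : Strategy V} (hf : A.IsStrategy B v .one f) :
    IsRun A .two bid tgt (trace tie B f (positional B .two bid tgt) v) := by
  have hg := positional_isStrategy (A := A) hB v .two bid ht
  refine ⟨fun n q => (play_isHistory hf hg tie n).budget_nonneg hB q, fun n => ⟨_, rfl, ?_⟩⟩
  have hh := play_isHistory hf hg tie n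
  simp only [trace, play, nextHistory]
  set h := play tie f (positional B .two bid tgt) v n
  cases hw : bidWinner tie h (f h) (positional B .two bid tgt h) with
  | one =>
    right
    have h1 := le_of_bidWinner_one hw
    refine ⟨(hf h hh).2.2, ?_, ?_⟩
    · simp [History.budget, History.spent]
    · simp only [History.current, History.budget, History.spent, Player.other, positional,
        if_true] at h1 ⊢
      linarith
  | two =>
    left
    simp only [History.current, History.budget, History.spent, Player.other, positional]
    refine ⟨trivial, ?_, ?_⟩ <;> (simp; try ring)

theorem trace_zero (tie : TieRule V) (B : Player → ℝ) (f g : Strategy V) (v : V) :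
    trace tie B f g v 0 = ⟨v, B⟩ := by
  simp only [trace, play, History.current, Config.mk.injEq, true_and]
  funext p
  simp [History.budget, History.spent]

theorem Arena.wins₁_of_isRun {A : Arena V} {B : Player → ℝ} (hB : IsBudget B) {v : V}
    (tie : TieRule V) {O : Objective V} (bid : V → ℝ → ℝ → ℝ) {tgt : V → V}
    (ht : ∀ v, A.Edge v (tgt v))
    (hO : ∀ τ, IsRun A .one bid tgt τ → τ 0 = ⟨v, B⟩ → τ ∈ O) : A.Wins₁ tie O v B :=
  ⟨_, positional_isStrategy hB v .one bid ht, fun _ hg =>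
    hO _ (isRun_trace_one hB tie bid ht hg) (trace_zero ..)⟩

theorem Arena.wins₂_of_isRun {A : Arena V} {B : Player → ℝ} (hB : IsBudget B) {v : V}
    (tie : TieRule V) {O : Objective V} (bid : V → ℝ → ℝ → ℝ) {tgt : V → V}
    (ht : ∀ v, A.Edge v (tgt v))
    (hO : ∀ τ, IsRun A .two bid tgt τ → τ 0 = ⟨v, B⟩ → τ ∉ O) : A.Wins₂ tie O v B :=
  ⟨_, positional_isStrategy hB v .two bid ht, fun _ hf =>
    hO _ (isRun_trace_two hB tie bid ht hf) (trace_zero ..)⟩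

/-! ### Uniqueness of threshold ratios. -/

theorem Arena.not_wins₁_and_wins₂ {A : Arena V} {B : Player → ℝ} {v : V} {tie : TieRule V}
    {O : Objective V} (h₁ : A.Wins₁ tie O v B) (h₂ : A.Wins₂ tie O v B) : False := by
  obtain ⟨f, hf, hf'⟩ := h₁
  obtain ⟨g, hg, hg'⟩ := h₂
  exact hg' f hf (hf' g hg)

/-- The budgets with sum `1` and ratio `r`. -/
def unitBudget (r : ℝ) : Player → ℝ
  | .one => r
  | .two => 1 - r

theorem isBudget_unitBudget {r : ℝ} (h : r ∈ Icc (0 : ℝ) 1) : IsBudget (unitBudget r) := by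
  refine ⟨fun p => ?_, by simp [unitBudget]⟩
  cases p
  · exact h.1
  · exact sub_nonneg.2 h.2

theorem ratio_unitBudget (r : ℝ) : ratio (unitBudget r) = r := by
  simp [ratio, unitBudget]

/-- At an initial ratio strictly between two thresholds both players would have winning strategies.
-/
theorem Arena.IsThreshold.le {A : Arena V} {tie : TieRule V} {O : Objective V} {v : V} {s t : ℝ}
    (hs : A.IsThreshold tie O v s) (ht : A.IsThreshold tie O v t) : t ≤ s := by
  by_contra! hlt
  have hB : IsBudget (unitBudget ((s + t) / 2)) :=
    isBudget_unitBudget ⟨by linarith [hs.1.1], by linarith [ht.1.2]⟩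
  exact not_wins₁_and_wins₂ ((hs.2 _ hB).1 (by rw [ratio_unitBudget]; linarith))
    ((ht.2 _ hB).2 (by rw [ratio_unitBudget]; linarith))

theorem Arena.IsThreshold.eq {A : Arena V} {tie : TieRule V} {O : Objective V} {v : V} {s t : ℝ}
    (hs : A.IsThreshold tie O v s) (ht : A.IsThreshold tie O v t) : s = t :=
  le_antisymm (ht.le hs) (hs.le ht)

theorem IsBudget.ratio_mem {B : Player → ℝ} (hB : IsBudget B) : ratio B ∈ Icc (0 : ℝ) 1 :=
  ⟨div_nonneg (hB.1 _) hB.2.le, (div_le_one hB.2).2 (by linarith [hB.1 .two])⟩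

/-! The mean payoff that a player can force when his ratio exceeds the probability with which he
moves the token in a random-turn game. -/

theorem exists_abs_le_of_finite {ι : Type*} [Finite ι] (f : ι → ℝ) :
    ∃ C, 0 ≤ C ∧ ∀ i, |f i| ≤ C := by
  obtain ⟨C, hC⟩ := (Set.finite_range fun i => |f i|).bddAbove
  exact ⟨max C 0, le_max_right _ _, fun i => (hC ⟨i, rfl⟩).trans (le_max_left _ _)⟩

theorem exists_pos_le_of_finite {ι : Type*} [Finite ι] (f : ι → ℝ) (hf : ∀ i, 0 < f i) :
    ∃ η, 0 < η ∧ ∀ i, η ≤ f i := by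
  rcases isEmpty_or_nonempty ι with h | h
  · exact ⟨1, one_pos, fun i => h.elim i⟩
  · obtain ⟨i, hi⟩ := Finite.exists_min f
    exact ⟨f i, hf i, hi⟩

/-! ### Payoff bounds from bounded partial sums. -/

theorem abs_energy_le [Finite V] (w : V → ℚ) :
    ∃ W, 0 ≤ W ∧ ∀ (π : ℕ → V) (n : ℕ), |energy w π n / n| ≤ W := by
  obtain ⟨W, hW0, hW⟩ := exists_abs_le_of_finite fun v => (w v : ℝ)
  refine ⟨W, hW0, fun π n => ?_⟩
  rcases Nat.eq_zero_or_pos n with rfl | hn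
  · simpa using hW0
  have hn' : (0 : ℝ) < n := by exact_mod_cast hn
  rw [abs_div, abs_of_pos hn', div_le_iff₀ hn']
  calc |energy w π n| ≤ ∑ j ∈ Finset.range (n - 1), |(w (π j) : ℝ)| :=
        Finset.abs_sum_le_sum_abs _ _
    _ ≤ ∑ _j ∈ Finset.range (n - 1), W := Finset.sum_le_sum fun j _ => hW _
    _ = ((n - 1 : ℕ) : ℝ) * W := by simp
    _ ≤ W * n := by
        rw [mul_comm]
        exact mul_le_mul_of_nonneg_left (by exact_mod_cast Nat.sub_le n 1) hW0

theorem tendsto_affine_div (M K : ℝ) :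
    Tendsto (fun n : ℕ => M + K / (n : ℝ)) atTop (nhds M) := by
  simpa using tendsto_const_nhds.add (tendsto_const_div_atTop_nhds_zero_nat K)

/-- A prefix with n vertices has only n - 1 summands, hence the extra -M in the numerator; it
vanishes after division by n. -/
theorem energy_div_eq (w : V → ℚ) (π : ℕ → V) (M : ℝ) {n : ℕ} (hn : 0 < n) :
    energy w π n / n =
      M + (∑ j ∈ Finset.range (n - 1), ((w (π j) : ℝ) - M) - M) / n := by
  have hn' : (n : ℝ) ≠ 0 := by exact_mod_cast hn.ne'
  rw [energy, Finset.sum_sub_distrib]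
  simp only [Finset.sum_const, Finset.card_range, nsmul_eq_mul, Nat.cast_pred hn]
  field_simp
  ring

theorem le_payoff [Finite V] {w : V → ℚ} {π : ℕ → V} {M K : ℝ}
    (hK : ∀ n, -K ≤ ∑ j ∈ Finset.range n, ((w (π j) : ℝ) - M)) : M ≤ payoff w π := by
  obtain ⟨W, -, hW⟩ := abs_energy_le w
  have ht := tendsto_affine_div M (-K - M)
  rw [← ht.liminf_eq]
  refine liminf_le_liminf ?_ ht.isBoundedUnder_ge ?_
  · filter_upwards [eventually_gt_atTop 0] with n hn
    rw [energy_div_eq w π M hn]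
    have := hK (n - 1)
    gcongr
  · exact IsBoundedUnder.isCoboundedUnder_ge
      ⟨W, eventually_map.2 (Eventually.of_forall fun n => (abs_le.1 (hW π n)).2)⟩

theorem payoff_le [Finite V] {w : V → ℚ} {π : ℕ → V} {M K : ℝ}
    (hK : ∀ n, ∑ j ∈ Finset.range n, ((w (π j) : ℝ) - M) ≤ K) : payoff w π ≤ M := by
  obtain ⟨W, -, hW⟩ := abs_energy_le w
  have ht := tendsto_affine_div M (K - M)
  rw [← ht.liminf_eq]
  refine liminf_le_liminf ?_
    ⟨-W, eventually_map.2 (Eventually.of_forall fun n => (abs_le.1 (hW π n)).1)⟩ ht.isCoboundedUnder_ge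
  filter_upwards [eventually_gt_atTop 0] with n hn
  rw [energy_div_eq w π M hn]
  have := hK (n - 1)
  gcongr

/-- On `S`, the optimality equation of the mean-payoff game in which the maximizer moves the token
with probability `p` and the minimizer with probability `1 - p`: the value is `M`, the potentials
are `h`, and optimal moves are `up` and `dn`. -/
def IsBellman (A : Arena V) (S : Set V) (w : V → ℝ) (p M : ℝ) (h : V → ℝ) (up dn : V → V) :
    Prop :=
  ∀ v ∈ S, A.Edge v (up v) ∧ A.Edge v (dn v) ∧
    (∀ u, A.Edge v u → h (dn v) ≤ h u ∧ h u ≤ h (up v)) ∧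
    h v + M = w v + p * h (up v) + (1 - p) * h (dn v)

/-- Exchanges the roles of the players, so that the bidding argument for Max also serves Min. -/
theorem IsBellman.neg {A : Arena V} {S : Set V} {w : V → ℝ} {p M : ℝ} {h : V → ℝ} {up dn : V → V}
    (hb : IsBellman A S w p M h up dn) :
    IsBellman A S (fun v => -w v) (1 - p) (-M) (fun v => -h v) dn up := by
  intro v hv
  obtain ⟨h1, h2, h3, h4⟩ := hb v hv
  exact ⟨h2, h1, fun u hu => ⟨neg_le_neg (h3 u hu).2, neg_le_neg (h3 u hu).1⟩, by linarith⟩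

/-- The bid of a player with budget `x` against budget `y`, at a vertex with potential gap `s`. -/
noncomputable def potentialBid (q a : ℝ) (s : V → ℝ) (v : V) (x y : ℝ) : ℝ :=
  a * s v * ((1 - q) * x - q * y)

/-- Winning multiplies D by 1 - (1-q)t and the exponential by at least 1 + (1-p)t. Losing multiplies
them by at least 1 + qt and 1 - pt. Both products are 1 + t(q - p) - O(t²), with a coefficient of t²
of size at most 1, so t ≤ q - p keeps them at least 1. -/
theorem potential_step {p q a t s x y x' y' b D Φ Φ' : ℝ} (hp : 0 ≤ p) (hpq : p < q) (hq : q ≤ 1)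
    (hs : a * s = t) (ha : 0 ≤ a) (ht : 0 ≤ t) (htq : t ≤ q - p)
    (hD : D = (1 - q) * x - q * y) (hD0 : 0 < D) (hb : b = t * D)
    (hstep : (x' = x - b ∧ y' = y ∧ Φ' = Φ + (1 - p) * s) ∨
      (x' = x ∧ y' ≤ y - b ∧ Φ - p * s ≤ Φ')) :
    D * Real.exp (a * Φ) ≤ ((1 - q) * x' - q * y') * Real.exp (a * Φ') := by
  subst hb
  have hE := Real.exp_pos (a * Φ)
  rcases hstep with ⟨rfl, rfl, rfl⟩ | ⟨rfl, hy, hΦ⟩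
  · have e1 : Real.exp (a * (Φ + (1 - p) * s)) = Real.exp (a * Φ) * Real.exp ((1 - p) * t) := by
      rw [← Real.exp_add, ← hs]
      ring_nf
    have e2 : (1 - q) * (x - t * D) - q * y' = D * (1 - (1 - q) * t) := by
      rw [hD]; ring
    rw [e1, e2]
    have e3 : 1 + (1 - p) * t ≤ Real.exp ((1 - p) * t) := by
      linarith [Real.add_one_le_exp ((1 - p) * t)]
    have e4 : 0 ≤ 1 - (1 - q) * t := by nlinarith
    have e5 : (1 - p) * (1 - q) * t ≤ t :=
      mul_le_of_le_one_left ht (mul_le_one₀ (by linarith) (by linarith) (by linarith))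
    have e6 : 1 ≤ (1 - (1 - q) * t) * Real.exp ((1 - p) * t) := by
      calc 1 ≤ (1 - (1 - q) * t) * (1 + (1 - p) * t) := by nlinarith
        _ ≤ _ := mul_le_mul_of_nonneg_left e3 e4
    calc D * Real.exp (a * Φ) = D * Real.exp (a * Φ) * 1 := by ring
      _ ≤ D * Real.exp (a * Φ) * ((1 - (1 - q) * t) * Real.exp ((1 - p) * t)) :=
          mul_le_mul_of_nonneg_left e6 (by positivity)
      _ = _ := by ring
  · have e1 : Real.exp (a * Φ) * Real.exp (-(p * t)) ≤ Real.exp (a * Φ') := by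
      rw [← Real.exp_add, Real.exp_le_exp, ← hs]
      nlinarith
    have e2 : D * (1 + q * t) ≤ (1 - q) * x' - q * y' := by
      have : q * y' ≤ q * (y - t * D) := mul_le_mul_of_nonneg_left hy (by linarith)
      nlinarith
    have e3 : 1 - p * t ≤ Real.exp (-(p * t)) := by
      linarith [Real.add_one_le_exp (-(p * t))]
    have e4 : 0 ≤ 1 + q * t := by nlinarith
    have e5 : p * q * t ≤ t :=
      mul_le_of_le_one_left ht (mul_le_one₀ (by linarith) (by linarith) (by linarith))
    have e6 : 1 ≤ (1 + q * t) * Real.exp (-(p * t)) := by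
      calc 1 ≤ (1 + q * t) * (1 - p * t) := by nlinarith
        _ ≤ _ := mul_le_mul_of_nonneg_left e3 e4
    calc D * Real.exp (a * Φ) = D * Real.exp (a * Φ) * 1 := by ring
      _ ≤ D * Real.exp (a * Φ) * ((1 + q * t) * Real.exp (-(p * t))) :=
          mul_le_mul_of_nonneg_left e6 (by positivity)
      _ = (D * (1 + q * t)) * (Real.exp (a * Φ) * Real.exp (-(p * t))) := by ring
      _ ≤ _ := mul_le_mul e2 e1 (by positivity)
          (le_trans (by positivity) e2)

/-- A player who uses potential bids in a closed set, and whose ratio exceeds `q > p` on entry,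
keeps the accumulated weight, relative to `M`, bounded from below. -/
theorem IsRun.sum_bddBelow [Finite V] {A : Arena V} {S : Set V} {w : V → ℝ} {p q a M : ℝ}
    {h : V → ℝ} {up dn : V → V} (hS : ∀ v ∈ S, ∀ u, A.Edge v u → u ∈ S)
    (hbell : IsBellman A S w p M h up dn) (hp : 0 ≤ p) (hpq : p < q) (hq : q ≤ 1) (ha : 0 < a)
    (has : ∀ v, a * (h (up v) - h (dn v)) ≤ q - p)
    {P : Player} {bid : V → ℝ → ℝ → ℝ} {tgt : V → V} {τ : ℕ → Config V} (hτ : IsRun A P bid tgt τ)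
    (hbid : ∀ v ∈ S, bid v = potentialBid q a (fun v => h (up v) - h (dn v)) v ∧ tgt v = up v)
    {n₀ : ℕ} (hn₀ : (τ n₀).vertex ∈ S)
    (hD : 0 < (1 - q) * (τ n₀).budget P - q * (τ n₀).budget P.other) :
    ∃ K, ∀ n, -K ≤ ∑ j ∈ Finset.range n, (w (τ j).vertex - M) := by
  set σ : ℕ → V := fun n => (τ n).vertex
  set x : ℕ → ℝ := fun n => (τ n).budget P
  set y : ℕ → ℝ := fun n => (τ n).budget P.other
  set Φ : ℕ → ℝ := fun n => ∑ j ∈ Finset.range n, (w (σ j) - M) + h (σ n)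
  set D : ℕ → ℝ := fun n => (1 - q) * x n - q * y n with hDdef
  have hinv : ∀ k, σ (n₀ + k) ∈ S ∧ x (n₀ + k) ≤ x n₀ ∧
      D n₀ * Real.exp (a * Φ n₀) ≤ D (n₀ + k) * Real.exp (a * Φ (n₀ + k)) := by
    intro k
    induction k with
    | zero => exact ⟨hn₀, le_rfl, le_rfl⟩
    | succ k ih =>
      obtain ⟨hσ, hx, hDe⟩ := ih
      set n := n₀ + k
      have hD0 : 0 < D n := by
        have : 0 < D n * Real.exp (a * Φ n) :=
          lt_of_lt_of_le (mul_pos hD (Real.exp_pos _)) hDe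
        exact pos_of_mul_pos_left this (Real.exp_pos _).le
      obtain ⟨β, hβ, hstep⟩ := hτ.step n
      obtain ⟨b1, b2, b3, b4⟩ := hbell _ hσ
      obtain ⟨hb1, hb2⟩ := hbid _ hσ
      have hs : 0 ≤ h (up (σ n)) - h (dn (σ n)) := by linarith [(b3 _ b2).2]
      have ht := has (σ n)
      set s := h (up (σ n)) - h (dn (σ n)) with hsdef
      have ht0 : 0 ≤ a * s := mul_nonneg ha.le hs
      have hx0 : 0 ≤ x n := hτ.nonneg n P
      have hy0 : 0 ≤ y n := hτ.nonneg n P.other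
      have hDx : D n ≤ x n := by
        have := mul_nonneg (hp.trans hpq.le) hx0
        have := mul_nonneg (hp.trans hpq.le) hy0
        simp only [hDdef]
        linarith
      -- The clipping is inactive: a · s ≤ q - p ≤ 1 and D is at most the player's budget.
      have hβ' : β = a * s * D n := by
        have e : bid (σ n) (x n) (y n) = a * s * D n := by rw [hb1]; rfl
        have e' : a * s * D n ≤ x n :=
          (mul_le_of_le_one_left hD0.le (by linarith)).trans hDx
        rw [hβ]
        change max 0 (min (bid (σ n) (x n) (y n)) (x n)) = _
        rw [e, min_eq_left e', max_eq_right (mul_nonneg ht0 hD0.le)]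
      have hβ0 : 0 ≤ β := hβ ▸ le_max_left _ _
      have hΦ : Φ (n + 1) = Φ n + (h (σ (n + 1)) - p * h (up (σ n)) - (1 - p) * h (dn (σ n))) := by
        simp only [Φ, Finset.sum_range_succ]
        linarith
      have hstep' : A.Edge (σ n) (σ (n + 1)) ∧ x (n + 1) ≤ x n ∧
          ((x (n + 1) = x n - β ∧ y (n + 1) = y n ∧ Φ (n + 1) = Φ n + (1 - p) * s) ∨
          (x (n + 1) = x n ∧ y (n + 1) ≤ y n - β ∧ Φ n - p * s ≤ Φ (n + 1))) := by
        rcases hstep with ⟨s1, s2, s3⟩ | ⟨s1, s2, s3⟩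
        · have s1' : σ (n + 1) = up (σ n) := s1.trans hb2
          refine ⟨s1' ▸ b1, ?_, .inl ⟨s2, s3, ?_⟩⟩
          · simp only [x]; linarith
          · rw [hΦ, s1', hsdef]; ring
        · refine ⟨s1, s2.le, .inr ⟨s2, s3, ?_⟩⟩
          have := (b3 _ s1).1
          rw [hΦ, hsdef]
          linarith
      obtain ⟨e1, e2, e3⟩ := hstep'
      exact ⟨hS _ hσ _ e1, e2.trans hx, hDe.trans
        (potential_step hp hpq hq rfl ha.le ht0 ht rfl hD0 hβ' e3)⟩
  obtain ⟨H, hH0, hH⟩ := exists_abs_le_of_finite h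
  have hc : 0 < D n₀ * Real.exp (a * Φ n₀) := mul_pos hD (Real.exp_pos _)
  set c := D n₀ * Real.exp (a * Φ n₀)
  -- The own budget never grows, so D ≤ x n₀ throughout; the invariant then bounds exp(aΦ) from
  -- below by c / x n₀.
  have hlow : ∀ k, Real.log (c / x n₀) / a - H ≤ ∑ j ∈ Finset.range (n₀ + k), (w (σ j) - M) := by
    intro k
    obtain ⟨-, hx, hDe⟩ := hinv k
    have hE := Real.exp_pos (a * Φ (n₀ + k))
    have hDx : D (n₀ + k) ≤ x n₀ := by
      have := mul_nonneg (hp.trans hpq.le) (hτ.nonneg (n₀ + k) P)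
      have := mul_nonneg (hp.trans hpq.le) (hτ.nonneg (n₀ + k) P.other)
      simp only [hDdef, x, y] at hx ⊢
      linarith
    have hcx : c ≤ x n₀ * Real.exp (a * Φ (n₀ + k)) :=
      hDe.trans (mul_le_mul_of_nonneg_right hDx hE.le)
    have hx0 : 0 < x n₀ := pos_of_mul_pos_left (hc.trans_le hcx) hE.le
    have : Real.log (c / x n₀) ≤ a * Φ (n₀ + k) := by
      rw [Real.log_le_iff_le_exp (div_pos hc hx0), div_le_iff₀ hx0, mul_comm]
      exact hcx
    have h1 : Real.log (c / x n₀) / a ≤ Φ (n₀ + k) := by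
      rw [div_le_iff₀ ha, mul_comm]; exact this
    have h2 := (abs_le.1 (hH (σ (n₀ + k)))).2
    simp only [Φ] at h1
    linarith
  obtain ⟨K, hK0, hK⟩ := exists_abs_le_of_finite
    fun n : Fin n₀ => ∑ j ∈ Finset.range n, (w (σ j) - M)
  refine ⟨max K (-(Real.log (c / x n₀) / a - H)), fun n => ?_⟩
  rcases lt_or_ge n n₀ with hn | hn
  · have := (abs_le.1 (hK ⟨n, hn⟩)).1
    exact le_trans (neg_le_neg (le_max_left _ _)) this
  · obtain ⟨k, rfl⟩ := Nat.exists_eq_add_of_le hn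
    exact le_trans (by linarith [le_max_right K (-(Real.log (c / x n₀) / a - H))]) (hlow k)

/-! Forcing the token into a target set with a sufficient ratio. -/

/-- The bid, in proportion to the sum of the budgets, that keeps the ratio above `U` if `U` bounds
the required ratios. -/
noncomputable def reachBid (U : V → ℝ) (next : V → V) (v : V) (x y : ℝ) : ℝ :=
  (U v - U (next v)) / (1 - U (next v)) * (x + y)

/-- The share of a player with budget `x` against budget `y`. -/
noncomputable def share (x y : ℝ) : ℝ := x / (x + y)

theorem share_le_one {x y : ℝ} (hy : 0 ≤ y) (h : 0 < x + y) : share x y ≤ 1 :=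
  (div_le_one h).2 (by linarith)

/-- The bid is what takes a share of exactly U to exactly U'. Paying it leaves the surplus x - U(x +
y) unchanged, now measured against U' and divided by a smaller total. -/
theorem share_win {x y U U' : ℝ} (hU0 : 0 ≤ U') (hUU : U' < U) (hU1 : U < 1) (h : 0 < x + y)
    (hs : U < share x y) {b : ℝ} (hb : b = (U - U') / (1 - U') * (x + y)) :
    0 ≤ b ∧ b ≤ x ∧ 0 < x - b + y ∧ share x y - U ≤ share (x - b) y - U' := by
  have h1 : 0 < 1 - U' := by linarith
  have hx : U * (x + y) < x := by rwa [share, lt_div_iff₀ h] at hs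
  have hb' : b * (1 - U') = (U - U') * (x + y) := by rw [hb]; field_simp
  have hb0 : 0 ≤ b := by
    rw [hb]
    exact mul_nonneg (div_nonneg (by linarith) h1.le) h.le
  have hbU : b ≤ U * (x + y) := by
    refine le_of_mul_le_mul_right ?_ h1
    rw [hb']
    nlinarith [mul_nonneg (mul_nonneg hU0 (by linarith : 0 ≤ 1 - U)) h.le]
  have hpos : 0 < x - b + y := by nlinarith
  refine ⟨hb0, hbU.trans hx.le, hpos, ?_⟩
  have e1 : share x y - U = (x - U * (x + y)) / (x + y) := by rw [share]; field_simp
  have e2 : share (x - b) y - U' = (x - U * (x + y)) / (x - b + y) := by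
    rw [share]
    field_simp
    linarith
  rw [e1, e2]
  exact div_le_div_of_nonneg_left (by linarith) hpos (by linarith)

/-- The opponent's payment shrinks the total at least by the factor (1-U)/(1-U'), so the share grows
at least by the inverse factor. -/
theorem share_lose {x y y' U U' u η : ℝ} (hU0 : 0 ≤ U') (hUU : U' < U) (hU1 : U < 1)
    (h : 0 < x + y) (hs : U < share x y) {b : ℝ} (hb : b = (U - U') / (1 - U') * (x + y))
    (hy' : 0 ≤ y') (hy : y' ≤ y - b) (hη : u + η ≤ U * (1 - U') / (1 - U)) :
    0 < x + y' ∧ share x y - U + η ≤ share x y' - u := by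
  have h1 : 0 < 1 - U' := by linarith
  have h2 : 0 < 1 - U := by linarith
  have hx : U * (x + y) < x := by rwa [share, lt_div_iff₀ h] at hs
  have hx0 : 0 < x := lt_of_le_of_lt (mul_nonneg (by linarith) h.le) hx
  have hpos : 0 < x + y' := by linarith
  refine ⟨hpos, ?_⟩
  have hb' : b * (1 - U') = (U - U') * (x + y) := by rw [hb]; field_simp
  have e1 : (x + y') * (1 - U') ≤ (1 - U) * (x + y) := by nlinarith
  have e2 : share x y * (1 - U') / (1 - U) ≤ share x y' := by
    rw [share, share, div_mul_eq_mul_div, div_div, div_le_div_iff₀ (by positivity) hpos]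
    nlinarith
  have e3 : share x y - U ≤ (share x y - U) * ((1 - U') / (1 - U)) :=
    le_mul_of_one_le_right (by linarith) ((one_le_div h2).2 (by linarith))
  have e4 : (share x y - U) * ((1 - U') / (1 - U)) =
      share x y * (1 - U') / (1 - U) - U * (1 - U') / (1 - U) := by ring
  linarith

/-- `U` is a strict bound on the ratios that are needed in order to reach `X`, when one moves along
`next`. -/
def IsStrictBound (A : Arena V) (X : Set V) (U : V → ℝ) (next : V → V) : Prop :=
  (∀ v, 0 ≤ U v) ∧ ∀ v ∉ X, A.Edge v (next v) ∧ (U v < 1 → U (next v) < U v ∧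
    ∀ u, A.Edge v u → U u * (1 - U v) < U v * (1 - U (next v)))

/-- Before `X` is hit, each lost bidding raises the excess d = share - U by at least η, and each won
bidding keeps d and lowers U by at least μ; finiteness makes η and μ uniform. Since d ≤ 1 and U is
bounded, this cannot go on forever. -/
theorem IsRun.exists_hit [Finite V] {A : Arena V} {X : Set V} {U : V → ℝ} {next : V → V}
    (hU : IsStrictBound A X U next) {P : Player} {bid : V → ℝ → ℝ → ℝ} {tgt : V → V}
    {τ : ℕ → Config V} (hτ : IsRun A P bid tgt τ)
    (hbid : ∀ v ∉ X, bid v = reachBid U next v ∧ tgt v = next v)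
    (h0 : 0 < (τ 0).budget P + (τ 0).budget P.other)
    (hs : U (τ 0).vertex < share ((τ 0).budget P) ((τ 0).budget P.other)) :
    ∃ n, (τ n).vertex ∈ X ∧ (∀ m < n, (τ m).vertex ∉ X) ∧
      0 < (τ n).budget P + (τ n).budget P.other ∧
      U (τ n).vertex < share ((τ n).budget P) ((τ n).budget P.other) := by
  classical
  obtain ⟨hU0, hU1⟩ := hU
  set σ : ℕ → V := fun n => (τ n).vertex
  set x : ℕ → ℝ := fun n => (τ n).budget P
  set y : ℕ → ℝ := fun n => (τ n).budget P.other
  obtain ⟨η, hη0, hη⟩ := exists_pos_le_of_finite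
    (fun e : {e : V × V // e.1 ∉ X ∧ U e.1 < 1 ∧ A.Edge e.1 e.2} =>
      U e.1.1 * (1 - U (next e.1.1)) / (1 - U e.1.1) - U e.1.2) (by
    rintro ⟨⟨v, u⟩, hv, hv1, hu⟩
    rw [sub_pos, lt_div_iff₀ (by simpa using hv1)]
    exact ((hU1 v hv).2 hv1).2 u hu)
  obtain ⟨μ, hμ0, hμ⟩ := exists_pos_le_of_finite
    (fun v : {v : V // v ∉ X ∧ U v < 1} => U v.1 - U (next v.1)) (by
    rintro ⟨v, hv, hv1⟩
    exact sub_pos.2 ((hU1 v hv).2 hv1).1)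
  obtain ⟨C, hC0, hC⟩ := exists_abs_le_of_finite U
  set d : ℕ → ℝ := fun n => share (x n) (y n) - U (σ n)
  have key : ∀ n, σ n ∉ X → 0 < x n + y n → U (σ n) < share (x n) (y n) →
      0 < x (n + 1) + y (n + 1) ∧ (d n ≤ d (n + 1) ∧ U (σ (n + 1)) + μ ≤ U (σ n) ∨
        d n + η ≤ d (n + 1)) := by
    intro n hX hpos hlt
    have hlt1 : U (σ n) < 1 := hlt.trans_le (share_le_one (hτ.nonneg n _) hpos)
    obtain ⟨-, hnx⟩ := hU1 _ hX
    obtain ⟨hnlt, -⟩ := hnx hlt1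
    obtain ⟨hb1, hb2⟩ := hbid _ hX
    obtain ⟨β, hβ, hstep⟩ := hτ.step n
    obtain ⟨w1, w2, w3, w4⟩ := share_win (hU0 _) hnlt hlt1 hpos hlt rfl
    have hβ' : β = (U (σ n) - U (next (σ n))) / (1 - U (next (σ n))) * (x n + y n) := by
      have e : bid (σ n) (x n) (y n) =
        (U (σ n) - U (next (σ n))) / (1 - U (next (σ n))) * (x n + y n) := by rw [hb1]; rfl
      rw [hβ]
      change max 0 (min (bid (σ n) (x n) (y n)) (x n)) = _
      rw [e, min_eq_left w2, max_eq_right w1]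
    rw [← hβ'] at w1 w2 w3 w4
    rcases hstep with ⟨s1, s2, s3⟩ | ⟨s1, s2, s3⟩
    · have s1' : σ (n + 1) = next (σ n) := s1.trans hb2
      change x (n + 1) = x n - β at s2
      change y (n + 1) = y n at s3
      refine ⟨by rw [s2, s3]; exact w3, .inl ⟨?_, ?_⟩⟩
      · simp only [d]
        rw [s1', s2, s3]
        exact w4
      · rw [s1']
        linarith [hμ ⟨σ n, hX, hlt1⟩]
    · change x (n + 1) = x n at s2
      have := hη ⟨(σ n, σ (n + 1)), hX, hlt1, s1⟩
      obtain ⟨l1, l2⟩ := share_lose (u := U (σ (n + 1))) (η := η) (hU0 _) hnlt hlt1 hpos hlt hβ'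
        (hτ.nonneg (n + 1) _) s3 (by linarith)
      rw [← s2] at l1
      refine ⟨l1, .inr ?_⟩
      simp only [d]
      rw [s2] at l1 ⊢
      exact l2
  have inv : ∀ n, (∀ m < n, σ m ∉ X) → 0 < x n + y n ∧ U (σ n) < share (x n) (y n) := by
    intro n
    induction n with
    | zero => exact fun _ => ⟨h0, hs⟩
    | succ n ih =>
      intro hn
      obtain ⟨i1, i2⟩ := ih fun m hm => hn m (hm.trans n.lt_succ_self)
      obtain ⟨k1, k2⟩ := key n (hn n n.lt_succ_self) i1 i2
      refine ⟨k1, ?_⟩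
      have : 0 < d n := sub_pos.2 i2
      have : 0 < d (n + 1) := by rcases k2 with k2 | k2 <;> linarith [k2]
      exact sub_pos.1 this
  have hex : ∃ n, σ n ∈ X := by
    by_contra! hno
    -- With this K a gain of η in d outweighs any change of U, at most 2C, and still leaves μ. So K
    -- · d - U grows by μ in every round.
    set K := (2 * C + μ) / η
    have hK : K * η = 2 * C + μ := by simp only [K]; field_simp
    have hK0 : 0 ≤ K := by positivity
    have grow : ∀ n : ℕ, n * μ - C ≤ K * d n - U (σ n) := by
      intro n
      induction n with
      | zero =>
        have := (abs_le.1 (hC (σ 0))).2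
        have : 0 ≤ K * d 0 := mul_nonneg hK0 (sub_pos.2 hs).le
        push_cast
        linarith
      | succ n ih =>
        obtain ⟨i1, i2⟩ := inv n fun m _ => hno m
        obtain ⟨-, k2⟩ := key n (hno n) i1 i2
        push_cast
        rcases k2 with ⟨k2, k3⟩ | k2
        · have := mul_le_mul_of_nonneg_left k2 hK0
          linarith
        · have := mul_le_mul_of_nonneg_left k2 hK0
          have := (abs_le.1 (hC (σ (n + 1)))).2
          have := (abs_le.1 (hC (σ n))).1
          linarith
    obtain ⟨n, hn⟩ := exists_nat_gt ((K + C) / μ)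
    rw [div_lt_iff₀ hμ0] at hn
    obtain ⟨i1, i2⟩ := inv n fun m _ => hno m
    have hd : d n ≤ 1 := by
      have := share_le_one (hτ.nonneg n P.other) i1
      have := hU0 (σ n)
      simp only [d, x, y]
      linarith
    have := mul_le_mul_of_nonneg_left hd hK0
    linarith [grow n, hU0 (σ n)]
  obtain ⟨i1, i2⟩ := inv (Nat.find hex) fun m hm => Nat.find_min hex hm
  exact ⟨Nat.find hex, Nat.find_spec hex, fun m hm => Nat.find_min hex hm, i1, i2⟩

/-! ### Threshold equations: strict bounds and existence of solutions. -/

/-- If `Y` is reachable from every vertex, then there is a rank that can be decreased outside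
`Y`. -/
theorem exists_rank {E : V → V → Prop} {Y : Set V}
    (h : ∀ v, ∃ u ∈ Y, Relation.ReflTransGen E v u) :
    ∃ k : V → ℕ, ∀ v ∉ Y, ∃ u, E v u ∧ k u < k v := by
  -- `D n v` means that a walk of length n leads from v into `Y`; the rank is the least such n.
  let D : ℕ → V → Prop := fun n => n.rec (· ∈ Y) fun _ P v => ∃ u, E v u ∧ P u
  have hD : ∀ v, ∃ n, D n v := by
    intro v
    obtain ⟨u, hu, hvu⟩ := h v
    induction hvu using Relation.ReflTransGen.head_induction_on with
    | refl => exact ⟨0, hu⟩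
    | head hab _ ih =>
      obtain ⟨n, hn⟩ := ih
      exact ⟨n + 1, _, hab, hn⟩
  refine ⟨fun v => sInf {n | D n v}, fun v hv => ?_⟩
  have hspec : D (sInf {n | D n v}) v := Nat.sInf_mem (hD v)
  cases hn : sInf {n | D n v} with
  | zero =>
    rw [hn] at hspec
    exact absurd hspec hv
  | succ n =>
    rw [hn] at hspec
    obtain ⟨u, hvu, hu⟩ := hspec
    refine ⟨u, hvu, ?_⟩
    change sInf {n | D n u} < sInf {n | D n v}
    rw [hn]
    exact Nat.lt_succ_of_le (Nat.sInf_le hu)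

/-- The equations that the threshold ratios of a reachability game satisfy outside the targets;
`up` and `dn` are the neighbors with the greatest and the least threshold. -/
def IsThresholdEq (A : Arena V) (X : Set V) (T : V → ℝ) (up dn : V → V) : Prop :=
  (∀ v, T v ∈ Icc (0 : ℝ) 1) ∧ ∀ v ∉ X, A.Edge v (up v) ∧ A.Edge v (dn v) ∧
    (∀ u, A.Edge v u → T (dn v) ≤ T u ∧ T u ≤ T (up v)) ∧
    T v * (T (up v) - T (dn v)) = T (up v) - T v

theorem IsThresholdEq.one_sub {A : Arena V} {X : Set V} {T : V → ℝ} {up dn : V → V}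
    (hT : IsThresholdEq A X T up dn) : IsThresholdEq A X (fun v => 1 - T v) dn up := by
  refine ⟨fun v => ⟨by linarith [(hT.1 v).2], by linarith [(hT.1 v).1]⟩, fun v hv => ?_⟩
  obtain ⟨h1, h2, h3, h4⟩ := hT.2 v hv
  exact ⟨h2, h1, fun u hu => ⟨by linarith [(h3 u hu).2], by linarith [(h3 u hu).1]⟩, by linarith⟩

/-- Raising T by a constant ε already creates slack ε(T⁺ - T⁻) at a vertex whose neighbors differ.
Where all neighbors have the same value there is none, and progress comes from a small correction: U
= T + ε - q, with q decaying geometrically in the distance to `X` or to a vertex of the first kind.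
-/
theorem IsThresholdEq.exists_strictBound [Finite V] {A : Arena V} {X : Set V} {T : V → ℝ}
    {up dn : V → V} (hT : IsThresholdEq A X T up dn)
    (hX : ∀ v, ∃ u ∈ X, Relation.ReflTransGen A.Edge v u) {ε : ℝ} (hε : 0 < ε) :
    ∃ U next, IsStrictBound A X U next ∧ ∀ v, T v + ε / 2 ≤ U v ∧ U v < T v + ε := by
  classical
  obtain ⟨hT01, hT⟩ := hT
  obtain ⟨k, hk⟩ := exists_rank (E := A.Edge) (Y := X ∪ {v | T (dn v) < T (up v)}) fun v => by
    obtain ⟨u, hu, hvu⟩ := hX v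
    exact ⟨u, .inl hu, hvu⟩
  have hgap : ∀ v ∉ X, T (dn v) < T (up v) → T (dn v) < T v := by
    intro v hv hlt
    have h4 := (hT v hv).2.2.2
    have hc := (hT01 (dn v)).1
    have ha := (hT01 (up v)).2
    by_contra! hle
    have : T v * (1 + T (up v) - T (dn v)) ≤ T (dn v) * (1 + T (up v) - T (dn v)) :=
      mul_le_mul_of_nonneg_right hle (by linarith)
    nlinarith [mul_pos (sub_pos.2 hlt) (sub_pos.2 (hlt.trans_le ha))]
  obtain ⟨γ, hγ0, hγ⟩ := exists_pos_le_of_finite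
    (fun v : {v : V // v ∉ X ∧ T (dn v) < T (up v)} =>
      min (T v.1 - T (dn v.1)) (ε * (T (up v.1) - T (dn v.1)) / 2)) (by
    rintro ⟨v, hv, hlt⟩
    exact lt_min (sub_pos.2 (hgap v hv hlt)) (half_pos (mul_pos hε (sub_pos.2 hlt))))
  -- θ caps the correction q: θ < γ preserves the strict inequalities at vertices with a gap, and θ
  -- ≤ ε/2 keeps U ≥ T + ε/2.
  obtain ⟨θ, hθ0, hθ1, hθ2⟩ : ∃ θ, 0 < θ ∧ θ ≤ ε / 2 ∧ θ < γ :=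
    ⟨min (ε / 2) (γ / 2), by positivity, min_le_left _ _,
      (min_le_right _ _).trans_lt (half_lt_self hγ0)⟩
  obtain ⟨K, hK1, hK2⟩ : ∃ K : ℝ, 1 < K ∧ 2 / ε < K :=
    ⟨2 / ε + 1, by linarith [div_pos two_pos hε], by linarith⟩
  have hK0 : 0 < K := by linarith
  rw [div_lt_iff₀ hε] at hK2
  set q : V → ℝ := fun v => θ * (K ^ k v)⁻¹
  have hq0 : ∀ v, 0 < q v := fun v => by positivity
  have hqθ : ∀ v, q v ≤ θ := fun v =>
    mul_le_of_le_one_right hθ0.le (inv_le_one_of_one_le₀ (one_le_pow₀ hK1.le))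
  have hqK : ∀ v u, k u < k v → K * q v ≤ q u := by
    intro v u hlt
    have : K ^ (k u + 1) ≤ K ^ k v := pow_le_pow_right₀ hK1.le hlt
    have h2 : (K ^ k v)⁻¹ ≤ (K ^ (k u + 1))⁻¹ := inv_anti₀ (by positivity) this
    have h3 : K * (K ^ (k u + 1))⁻¹ = (K ^ k u)⁻¹ := by
      rw [pow_succ]; field_simp
    calc K * q v = θ * (K * (K ^ k v)⁻¹) := by simp only [q]; ring
      _ ≤ θ * (K * (K ^ (k u + 1))⁻¹) := by gcongr
      _ = q u := by rw [h3]
  choose! nx hnx using hk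
  refine ⟨fun v => T v + ε - q v,
    fun v => if T (dn v) < T (up v) then dn v else nx v, ⟨fun v => ?_, fun v hv => ?_⟩, fun v => ?_⟩
  · linarith [(hT01 v).1, hqθ v]
  · obtain ⟨h1, h2, h3, h4⟩ := hT v hv
    have ht0 := (hT01 v).1
    have hqv := hqθ v
    have hqv0 := hq0 v
    by_cases hlt : T (dn v) < T (up v)
    · simp only [hlt, if_true]
      refine ⟨h2, fun hv1 => ?_⟩
      have hg := hγ ⟨v, hv, hlt⟩
      have hg1 := hg.trans (min_le_left _ _)
      have hg2 := hg.trans (min_le_right _ _)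
      have hqd := hq0 (dn v)
      refine ⟨by dsimp only at hg1; linarith, fun u hu => ?_⟩
      obtain ⟨h5, h6⟩ := h3 u hu
      have hqu := hq0 u
      have ha := (hT01 (up v)).2
      have hc := (hT01 (dn v)).1
      dsimp only at hg1 hg2
      calc (T u + ε - q u) * (1 - (T v + ε - q v))
          ≤ (T (up v) + ε) * (1 - (T v + ε - q v)) :=
            mul_le_mul_of_nonneg_right (by linarith) (by linarith)
        _ < (T v + ε - q v) * (1 - (T (dn v) + ε)) := by
            have e : (T v + ε - q v) * (1 - (T (dn v) + ε)) -
                (T (up v) + ε) * (1 - (T v + ε - q v)) =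
                T v * (T (up v) - T (dn v)) - (T (up v) - T v) + ε * (T (up v) - T (dn v)) -
                  q v * (1 + T (up v) - T (dn v)) := by ring
            have e2 : q v * (1 + T (up v) - T (dn v)) ≤ q v * 2 :=
              mul_le_mul_of_nonneg_left (by linarith) hqv0.le
            linarith
        _ ≤ _ := mul_le_mul_of_nonneg_left (by linarith) (by linarith)
    · simp only [hlt, if_false]
      have hY : v ∉ X ∪ {v | T (dn v) < T (up v)} := by simp [hv, hlt]
      obtain ⟨hE, hkk⟩ := hnx v hY
      have hac : T (up v) = T (dn v) := le_antisymm (not_lt.1 hlt) ((h3 _ h2).2)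
      rw [hac, sub_self, mul_zero] at h4
      have hTu : ∀ u, A.Edge v u → T u = T v := fun u hu =>
        le_antisymm (by linarith [(h3 u hu).2]) (by linarith [(h3 u hu).1])
      have hq' := hqK v _ hkk
      refine ⟨hE, fun hv1 => ?_⟩
      rw [hTu _ hE]
      have hlt' : q v < q (nx v) := lt_of_lt_of_le (by nlinarith) hq'
      refine ⟨by linarith, fun u hu => ?_⟩
      rw [hTu u hu]
      have hqu := hq0 u
      have e1 : (T v + ε - q u) * (1 - (T v + ε - q v)) ≤ (T v + ε) * (1 - (T v + ε - q v)) :=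
        mul_le_mul_of_nonneg_right (by linarith) (by linarith)
      -- With all T equal the required inequality reduces to this one; it is why K exceeds 2/ε.
      have e2 : q v < (T v + ε - q v) * q (nx v) := by
        calc q v = q v * 2 / 2 := by ring
          _ < q v * (K * ε) / 2 := by gcongr
          _ = ε / 2 * (K * q v) := by ring
          _ ≤ (T v + ε - q v) * q (nx v) :=
            mul_le_mul (by linarith) hq' (by positivity) (by linarith)
      nlinarith
  · exact ⟨by linarith [hqθ v], by linarith [hq0 v]⟩

/-- The threshold of a vertex whose neighbors have greatest threshold `a` and least threshold
`c`. -/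
noncomputable def thresholdStep (a c : ℝ) : ℝ := a / (1 - c + a)

theorem thresholdStep_mem {a c : ℝ} (hc0 : 0 ≤ c) (hca : c ≤ a) (ha : a ≤ 1) :
    thresholdStep a c ∈ Icc (0 : ℝ) 1 :=
  ⟨div_nonneg (by linarith) (by linarith), (div_le_one (by linarith)).2 (by linarith)⟩

theorem thresholdStep_mono {a c a' c' : ℝ} (hc0 : 0 ≤ c) (hca : c ≤ a) (hca' : c' ≤ a')
    (ha' : a' ≤ 1) (haa : a ≤ a') (hcc : c ≤ c') : thresholdStep a c ≤ thresholdStep a' c' := by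
  rw [thresholdStep, thresholdStep, div_le_div_iff₀ (by linarith) (by linarith)]
  nlinarith

theorem exists_extremal_neighbors [Finite V] (A : Arena V) (T : V → ℝ) :
    ∃ up dn : V → V, ∀ v, A.Edge v (up v) ∧ A.Edge v (dn v) ∧
      ∀ u, A.Edge v u → T (dn v) ≤ T u ∧ T u ≤ T (up v) := by
  have h : ∀ v, ∃ a b, A.Edge v a ∧ A.Edge v b ∧ ∀ u, A.Edge v u → T b ≤ T u ∧ T u ≤ T a := by
    intro v
    have hfin := Set.toFinite {u | A.Edge v u}
    obtain ⟨a, ha, ha'⟩ := Set.exists_max_image _ T hfin (A.exists_edge v)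
    obtain ⟨b, hb, hb'⟩ := Set.exists_min_image _ T hfin (A.exists_edge v)
    exact ⟨a, b, ha, hb, fun u hu => ⟨hb' u hu, ha' u hu⟩⟩
  choose up dn h using h
  exact ⟨up, dn, h⟩

/-- The equations are the fixed-point equations of a monotone operator on the complete lattice of
functions into [0,1]. -/
theorem exists_isThresholdEq [Finite V] (A : Arena V) (X : Set V) (r : V → ℝ)
    (hr : ∀ v ∈ X, r v ∈ Icc (0 : ℝ) 1) :
    ∃ T up dn, IsThresholdEq A X T up dn ∧ ∀ v ∈ X, T v = r v := by
  classical
  have : Fact ((0 : ℝ) ≤ 1) := ⟨zero_le_one⟩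
  choose up dn hud using fun T : V → ℝ => exists_extremal_neighbors A T
  let val : (V → Icc (0 : ℝ) 1) → V → ℝ := fun T v => T v
  let F : (V → Icc (0 : ℝ) 1) →o (V → Icc (0 : ℝ) 1) :=
    { toFun := fun T v => if hv : v ∈ X then ⟨r v, hr v hv⟩ else
        ⟨thresholdStep (T (up (val T) v)) (T (dn (val T) v)),
          thresholdStep_mem (T _).2.1 ((hud (val T) v).2.2 _ (hud (val T) v).2.1).2 (T _).2.2⟩
      monotone' := by
        intro T T' hTT v
        by_cases hv : v ∈ X
        · simp [hv]
        · simp only [hv, dif_neg, not_false_eq_true, Subtype.mk_le_mk]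
          obtain ⟨h1, h2, h3⟩ := hud (val T) v
          obtain ⟨h1', h2', h3'⟩ := hud (val T') v
          exact thresholdStep_mono (T _).2.1 (h3 _ h2).2 (h3' _ h2').2 (T' _).2.2
            ((Subtype.coe_le_coe.2 (hTT _)).trans (h3' _ h1).2)
            ((h3 _ h2').1.trans (Subtype.coe_le_coe.2 (hTT _))) }
  have hfix : F F.lfp = F.lfp := F.map_lfp
  set T := F.lfp
  refine ⟨val T, up (val T), dn (val T), ⟨fun v => (T v).2, fun v hv => ?_⟩, fun v hv => ?_⟩
  · obtain ⟨h1, h2, h3⟩ := hud (val T) v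
    refine ⟨h1, h2, h3, ?_⟩
    have e : val T v = thresholdStep (val T (up (val T) v)) (val T (dn (val T) v)) := by
      conv_lhs => simp only [val]; rw [← hfix]
      simp [F, hv, val]
    have hpos : 0 < 1 - val T (dn (val T) v) + val T (up (val T) v) := by
      linarith [(h3 _ h2).2]
    rw [thresholdStep, eq_div_iff hpos.ne'] at e
    linarith
  · have : F T v = ⟨r v, hr v hv⟩ := dif_pos hv
    rw [hfix] at this
    exact congrArg Subtype.val this

/-! Existence of solutions of the optimality equation in strongly-connected arenas, and their
dependence on the probability. -/

/-- Banach's theorem: the greatest and least neighbor values are 1-Lipschitz in the sup norm, so the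
discounted operator contracts by l. -/
theorem exists_discounted [Finite V] (A : Arena V) (w : V → ℝ) {p l : ℝ} (hp : p ∈ Icc (0 : ℝ) 1)
    (hl0 : 0 ≤ l) (hl1 : l < 1) {up dn : (V → ℝ) → V → V}
    (hud : ∀ h v, A.Edge v (up h v) ∧ A.Edge v (dn h v) ∧
      ∀ u, A.Edge v u → h (dn h v) ≤ h u ∧ h u ≤ h (up h v)) :
    ∃ h : V → ℝ, ∀ v, h v = w v + l * (p * h (up h v) + (1 - p) * h (dn h v)) := by
  have := Fintype.ofFinite V
  let F : (V → ℝ) → V → ℝ := fun h v => w v + l * (p * h (up h v) + (1 - p) * h (dn h v))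
  have hle : ∀ g h : V → ℝ, ∀ v, F g v ≤ F h v + l * dist g h := by
    intro g h v
    obtain ⟨-, g2, g3⟩ := hud g v
    obtain ⟨-, h2, h3⟩ := hud h v
    obtain ⟨g1, -, -⟩ := hud g v
    have hd : ∀ u, g u ≤ h u + dist g h := fun u => by
      have := (le_abs_self _).trans ((Real.dist_eq (g u) (h u)).symm.le.trans (dist_le_pi_dist g h u))
      linarith
    have e1 : p * g (up g v) ≤ p * (h (up h v) + dist g h) :=
      mul_le_mul_of_nonneg_left ((hd _).trans (by linarith [(h3 _ g1).2])) hp.1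
    have e2 : (1 - p) * g (dn g v) ≤ (1 - p) * (h (dn h v) + dist g h) :=
      mul_le_mul_of_nonneg_left ((g3 _ h2).1.trans (hd _)) (by linarith [hp.2])
    have e3 : l * (p * g (up g v) + (1 - p) * g (dn g v)) ≤
        l * (p * h (up h v) + (1 - p) * h (dn h v) + dist g h) :=
      mul_le_mul_of_nonneg_left (by linarith) hl0
    simp only [F]
    linarith
  have hF : ContractingWith ⟨l, hl0⟩ F := by
    refine ⟨by exact_mod_cast hl1, LipschitzWith.of_dist_le_mul fun g h => ?_⟩
    change dist (F g) (F h) ≤ l * dist g h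
    refine (dist_pi_le_iff (mul_nonneg hl0 dist_nonneg)).2 fun v => ?_
    rw [Real.dist_eq, abs_le]
    have h1 := hle g h v
    have h2 := hle h g v
    rw [dist_comm h g] at h2
    constructor <;> linarith
  have hfix : F (hF.fixedPoint F) = hF.fixedPoint F := hF.fixedPoint_isFixedPt
  exact ⟨hF.fixedPoint F, fun v => (congrFun hfix v).symm⟩

theorem exists_bound_of_reflTransGen {E : V → V → Prop} {v u : V}
    (h : Relation.ReflTransGen E v u) (W : ℝ) :
    ∃ C, ∀ d : V → ℝ, (∀ a b, E a b → d b ≤ 4 * d a + 8 * W) → d v ≤ 0 → d u ≤ C := by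
  induction h with
  | refl => exact ⟨0, fun d _ h => h⟩
  | tail _ hbc ih =>
    obtain ⟨C, hC⟩ := ih
    exact ⟨4 * C + 8 * W, fun d hd h => by linarith [hd _ _ hbc, hC d hd h]⟩

/-- The bound must not depend on p or on l, as l will tend to 1. If p ≥ 1/2, the maximizer takes any
given edge with weight at least 1/4 after discounting, so h above its minimum grows by a controlled
amount along edges, hence along a path from a minimum to a maximum. If p ≤ 1/2 the minimizer argues
backwards from a maximum. -/
theorem exists_span_bound [Finite V] [Nonempty V] (A : Arena V)
    (hA : ∀ v u, Relation.ReflTransGen A.Edge v u) (w : V → ℝ) :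
    ∃ C W, ∀ p ∈ Icc (0 : ℝ) 1, ∀ l ∈ Ico (1 / 2 : ℝ) 1, ∀ (h : V → ℝ) (up dn : V → V),
      (∀ v, A.Edge v (up v) ∧ A.Edge v (dn v) ∧
        ∀ u, A.Edge v u → h (dn v) ≤ h u ∧ h u ≤ h (up v)) →
      (∀ v, h v = w v + l * (p * h (up v) + (1 - p) * h (dn v))) →
      (∀ v u, h v - h u ≤ C) ∧ ∀ v, |(1 - l) * h v| ≤ W := by
  obtain ⟨W, hW0, hW⟩ := exists_abs_le_of_finite w
  choose c hc using fun v u => exists_bound_of_reflTransGen (hA v u) W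
  obtain ⟨C, hC0, hC⟩ := exists_abs_le_of_finite fun e : V × V => c e.1 e.2
  refine ⟨C, W, fun p hp l hl h up dn hud heq => ?_⟩
  obtain ⟨v₀, hv₀⟩ := Finite.exists_min h
  obtain ⟨v₁, hv₁⟩ := Finite.exists_max h
  have hp0 : 0 ≤ 1 - p := by linarith [hp.2]
  have hl0 : 0 ≤ l := by linarith [hl.1]
  have hlo : ∀ v, h v₀ ≤ p * h (up v) + (1 - p) * h (dn v) := fun v => by
    linarith [mul_le_mul_of_nonneg_left (hv₀ (up v)) hp.1,
      mul_le_mul_of_nonneg_left (hv₀ (dn v)) hp0]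
  have hhi : ∀ v, p * h (up v) + (1 - p) * h (dn v) ≤ h v₁ := fun v => by
    linarith [mul_le_mul_of_nonneg_left (hv₁ (up v)) hp.1,
      mul_le_mul_of_nonneg_left (hv₁ (dn v)) hp0]
  have hm : -W ≤ (1 - l) * h v₀ := by
    linarith [heq v₀, (abs_le.1 (hW v₀)).1, mul_le_mul_of_nonneg_left (hlo v₀) hl0]
  have hM : (1 - l) * h v₁ ≤ W := by
    linarith [heq v₁, (abs_le.1 (hW v₁)).2, mul_le_mul_of_nonneg_left (hhi v₁) hl0]
  have hl1 : 0 ≤ 1 - l := by linarith [hl.2]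
  have hmv : ∀ v, (1 - l) * h v₀ ≤ (1 - l) * h v := fun v =>
    mul_le_mul_of_nonneg_left (hv₀ v) hl1
  have hMv : ∀ v, (1 - l) * h v ≤ (1 - l) * h v₁ := fun v =>
    mul_le_mul_of_nonneg_left (hv₁ v) hl1
  refine ⟨?_, fun v => abs_le.2 ⟨hm.trans (hmv v), (hMv v).trans hM⟩⟩
  suffices hs : h v₁ - h v₀ ≤ C from fun v u => by linarith [hv₁ v, hv₀ u]
  rcases le_total (1 / 2) p with hp2 | hp2
  · refine (hc v₀ v₁ (fun v => h v - h v₀) (fun a b hab => ?_) (by simp)).trans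
      ((le_abs_self _).trans (hC (v₀, v₁)))
    obtain ⟨-, -, h3⟩ := hud a
    have hb0 : 0 ≤ h b - h v₀ := by linarith [hv₀ b]
    have e1 : 1 / 2 * (h b - h v₀) ≤ p * (h (up a) - h v₀) :=
      mul_le_mul hp2 (by linarith [(h3 b hab).2]) hb0 hp.1
    have e2 : 0 ≤ (1 - p) * (h (dn a) - h v₀) := mul_nonneg hp0 (by linarith [hv₀ (dn a)])
    have e3 : 1 / 2 * (1 / 2 * (h b - h v₀)) ≤
        l * (p * (h (up a) - h v₀) + (1 - p) * (h (dn a) - h v₀)) :=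
      mul_le_mul hl.1 (by linarith) (by linarith) hl0
    linarith [heq a, (abs_le.1 (hW a)).1, hmv v₁]
  · refine (hc v₁ v₀ (fun v => h v₁ - h v) (fun a b hab => ?_) (by simp)).trans
      ((le_abs_self _).trans (hC (v₁, v₀)))
    obtain ⟨-, -, h3⟩ := hud a
    have hb0 : 0 ≤ h v₁ - h b := by linarith [hv₁ b]
    have e1 : 1 / 2 * (h v₁ - h b) ≤ (1 - p) * (h v₁ - h (dn a)) :=
      mul_le_mul (by linarith) (by linarith [(h3 b hab).1]) hb0 hp0
    have e2 : 0 ≤ p * (h v₁ - h (up a)) := mul_nonneg hp.1 (by linarith [hv₁ (up a)])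
    have e3 : 1 / 2 * (1 / 2 * (h v₁ - h b)) ≤
        l * (p * (h v₁ - h (up a)) + (1 - p) * (h v₁ - h (dn a))) :=
      mul_le_mul hl.1 (by linarith) (by linarith) hl0
    linarith [heq a, (abs_le.1 (hW a)).2, hmv v₁]

/-- Vanishing discount: the potentials relative to a base vertex and the scaled values (1 - l) h(v₀)
stay in a compact set, and a limit point as l → 1 solves the undiscounted equation. -/
theorem exists_isBellman [Finite V] [Nonempty V] (A : Arena V)
    (hA : ∀ v u, Relation.ReflTransGen A.Edge v u) (w : V → ℝ) :
    ∃ C, ∀ p ∈ Icc (0 : ℝ) 1, ∃ M h up dn, IsBellman A univ w p M h up dn ∧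
      ∀ v u, h v - h u ≤ C := by
  have := Fintype.ofFinite V
  choose up dn hud using fun h : V → ℝ => exists_extremal_neighbors A h
  obtain ⟨C, W, hCW⟩ := exists_span_bound A hA w
  refine ⟨C, fun p hp => ?_⟩
  let l : ℕ → ℝ := fun n => 1 - 1 / ((n : ℝ) + 2)
  have hl : ∀ n, l n ∈ Ico (1 / 2 : ℝ) 1 := by
    intro n
    have h1 : (0 : ℝ) < (n : ℝ) + 2 := by positivity
    have h2 : 1 / ((n : ℝ) + 2) ≤ 1 / 2 :=
      one_div_le_one_div_of_le two_pos (by linarith [n.cast_nonneg (α := ℝ)])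
    exact ⟨by simp only [l]; linarith, by simp only [l]; linarith [one_div_pos.2 h1]⟩
  have hlt : Tendsto l atTop (nhds 1) := by
    have : Tendsto (fun n : ℕ => 1 / ((n : ℝ) + 2)) atTop (nhds 0) := by
      simp only [one_div]
      exact tendsto_inv_atTop_zero.comp
        (tendsto_atTop_add_const_right _ _ tendsto_natCast_atTop_atTop)
    simpa [l] using (tendsto_const_nhds (x := (1 : ℝ))).sub this
  choose h hh using fun n => exists_discounted A w hp (by linarith [(hl n).1]) (hl n).2 hud
  choose hC hW using fun n => hCW p hp (l n) (hl n) (h n) _ _ (hud (h n)) (hh n)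
  obtain ⟨v₀⟩ := ‹Nonempty V›
  let g : ℕ → V → ℝ := fun n v => h n v - h n v₀
  have hcpt : IsCompact (Icc (-W) W ×ˢ Icc (fun _ : V => -C) (fun _ => C)) :=
    isCompact_Icc.prod isCompact_Icc
  obtain ⟨⟨M, k⟩, hk, φ, hφ, hlim⟩ := hcpt.tendsto_subseq
    (x := fun n => ((1 - l n) * h n v₀, g n)) fun n =>
      ⟨abs_le.1 (hW n v₀), fun v => by linarith [hC n v₀ v], fun v => hC n v v₀⟩
  have hM : Tendsto (fun n => (1 - l (φ n)) * h (φ n) v₀) atTop (nhds M) :=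
    (continuous_fst.tendsto _).comp hlim
  have hg : Tendsto (fun n => g (φ n)) atTop (nhds k) := (continuous_snd.tendsto _).comp hlim
  have hgv : ∀ v, Tendsto (fun n => g (φ n) v) atTop (nhds (k v)) := fun v =>
    (tendsto_pi_nhds.1 hg) v
  have hl' := hlt.comp hφ.tendsto_atTop
  have hd0 : Tendsto (fun n => dist (g (φ n)) k) atTop (nhds 0) := tendsto_iff_dist_tendsto_zero.1 hg
  have hcoord : ∀ n u, |g n u - k u| ≤ dist (g n) k := fun n u => dist_le_pi_dist (g n) k u
  -- The maximizing neighbor may change with n, but the maximal value depends continuously on the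
  -- potentials.
  have hup : ∀ v, Tendsto (fun n => g (φ n) (up (h (φ n)) v)) atTop (nhds (k (up k v))) := by
    intro v
    refine tendsto_iff_dist_tendsto_zero.2 (squeeze_zero (fun _ => dist_nonneg) (fun n => ?_) hd0)
    rw [Real.dist_eq, abs_le]
    obtain ⟨a1, -, a3⟩ := hud (h (φ n)) v
    obtain ⟨b1, -, b3⟩ := hud k v
    have e1 := (a3 _ b1).2
    have e2 := (b3 _ a1).2
    have e3 := abs_le.1 (hcoord (φ n) (up k v))
    have e4 := abs_le.1 (hcoord (φ n) (up (h (φ n)) v))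
    simp only [g] at e3 e4 ⊢
    constructor <;> linarith
  have hdn : ∀ v, Tendsto (fun n => g (φ n) (dn (h (φ n)) v)) atTop (nhds (k (dn k v))) := by
    intro v
    refine tendsto_iff_dist_tendsto_zero.2 (squeeze_zero (fun _ => dist_nonneg) (fun n => ?_) hd0)
    rw [Real.dist_eq, abs_le]
    obtain ⟨-, a1, a3⟩ := hud (h (φ n)) v
    obtain ⟨-, b1, b3⟩ := hud k v
    have e1 := (a3 _ b1).1
    have e2 := (b3 _ a1).1
    have e3 := abs_le.1 (hcoord (φ n) (dn k v))
    have e4 := abs_le.1 (hcoord (φ n) (dn (h (φ n)) v))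
    simp only [g] at e3 e4 ⊢
    constructor <;> linarith
  refine ⟨M, k, up k, dn k, fun v _ => ?_, fun v u => ?_⟩
  · obtain ⟨h1, h2, h3⟩ := hud k v
    refine ⟨h1, h2, h3, ?_⟩
    have t1 := (hgv v).add hM
    have t2 := (hl'.mul (((hup v).const_mul p).add ((hdn v).const_mul (1 - p)))).const_add (w v)
    have := tendsto_nhds_unique (t1.congr fun n => ?_) t2
    · linarith
    · have := hh (φ n) v
      simp only [g, Function.comp]
      linarith
  · exact le_of_tendsto ((hgv v).sub (hgv u)) (Eventually.of_forall fun n => by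
      simp only [g]
      linarith [hC (φ n) v u])

/-- A maximum principle: compare the two equations where h' - h is greatest. Both monotonicity and
the Lipschitz bound of the value in p follow. -/
theorem IsBellman.exists_sub_le [Finite V] [Nonempty V] {A : Arena V} {w : V → ℝ} {p M p' M' : ℝ}
    {h h' : V → ℝ} {up dn up' dn' : V → V} (hp' : p' ∈ Icc (0 : ℝ) 1)
    (hb : IsBellman A univ w p M h up dn) (hb' : IsBellman A univ w p' M' h' up' dn') :
    ∃ v, M' - M ≤ (p' - p) * (h (up v) - h (dn v)) := by
  obtain ⟨v, hv⟩ := Finite.exists_max fun v => h' v - h v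
  refine ⟨v, ?_⟩
  obtain ⟨-, b2, b3, b4⟩ := hb v trivial
  obtain ⟨c1, -, c3, c4⟩ := hb' v trivial
  have e1 : p' * h' (up' v) ≤ p' * (h (up v) + (h' v - h v)) :=
    mul_le_mul_of_nonneg_left (by linarith [hv (up' v), (b3 _ c1).2]) hp'.1
  have e2 : (1 - p') * h' (dn' v) ≤ (1 - p') * (h (dn v) + (h' v - h v)) :=
    mul_le_mul_of_nonneg_left (by linarith [hv (dn v), (c3 _ b2).1]) (by linarith [hp'.2])
  linarith

/-- The value of the random-turn mean-payoff game on a strongly-connected arena. -/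
theorem exists_randomTurnValue [Finite V] [Nonempty V] (A : Arena V)
    (hA : ∀ v u, Relation.ReflTransGen A.Edge v u) (w : V → ℝ) :
    ∃ M : ℝ → ℝ, MonotoneOn M (Icc 0 1) ∧ ContinuousOn M (Icc 0 1) ∧
      ∀ p ∈ Icc (0 : ℝ) 1, ∃ h up dn, IsBellman A univ w p (M p) h up dn := by
  obtain ⟨C, hC⟩ := exists_isBellman A hA w
  choose! M h up dn hb hspan using hC
  have hC0 : 0 ≤ C := by
    obtain ⟨v⟩ := ‹Nonempty V›
    simpa using hspan 0 ⟨le_rfl, zero_le_one⟩ v v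
  have hmono : MonotoneOn M (Icc 0 1) := by
    intro p hp p' hp' hpp
    obtain ⟨v, hv⟩ := (hb p' hp').exists_sub_le hp (hb p hp)
    obtain ⟨-, b2, b3, -⟩ := hb p' hp' v trivial
    have := mul_nonneg (sub_nonneg.2 hpp) (sub_nonneg.2 (b3 _ b2).2)
    linarith
  have hlip : ∀ p ∈ Icc (0 : ℝ) 1, ∀ p' ∈ Icc (0 : ℝ) 1, p ≤ p' → M p' - M p ≤ C * (p' - p) := by
    intro p hp p' hp' hpp
    obtain ⟨v, hv⟩ := (hb p hp).exists_sub_le hp' (hb p' hp')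
    have := mul_le_mul_of_nonneg_left (hspan p hp (up p v) (dn p v)) (sub_nonneg.2 hpp)
    linarith
  refine ⟨M, hmono, ?_, fun p hp => ⟨h p, up p, dn p, hb p hp⟩⟩
  refine (LipschitzOnWith.of_dist_le_mul (K := ⟨C, hC0⟩) fun p hp p' hp' => ?_).continuousOn
  change dist (M p) (M p') ≤ C * dist p p'
  rw [Real.dist_eq, Real.dist_eq, abs_le]
  rcases le_total p p' with hpp | hpp
  · rw [abs_of_nonpos (sub_nonpos.2 hpp)]
    constructor <;> linarith [hlip p hp p' hp' hpp, hmono hp hp' hpp,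
      mul_nonneg hC0 (sub_nonneg.2 hpp)]
  · rw [abs_of_nonneg (sub_nonneg.2 hpp)]
    constructor <;> linarith [hlip p' hp' p hp hpp, hmono hp' hp hpp,
      mul_nonneg hC0 (sub_nonneg.2 hpp)]

/-! The value and the ratio of a strongly-connected mean-payoff game. -/

theorem exists_scale [Finite V] (s : V → ℝ) {δ : ℝ} (hδ : 0 < δ) :
    ∃ a, 0 < a ∧ ∀ v, a * s v ≤ δ := by
  obtain ⟨C, hC0, hC⟩ := exists_abs_le_of_finite s
  refine ⟨δ / (C + 1), by positivity, fun v => ?_⟩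
  rw [div_mul_eq_mul_div, div_le_iff₀ (by positivity)]
  exact mul_le_mul_of_nonneg_left (by linarith [(abs_le.1 (hC v)).2]) hδ.le

theorem share_eq_one_sub_ratio {B : Player → ℝ} (hB : 0 < B .one + B .two) :
    share (B .two) (B .one) = 1 - ratio B := by
  rw [share, ratio, add_comm (B .two), eq_sub_iff_add_eq, ← add_div, add_comm (B .two),
    div_self hB.ne']

theorem lt_share_iff {q x y : ℝ} (h : 0 < x + y) : q < share x y ↔ 0 < (1 - q) * x - q * y := by
  rw [share, lt_div_iff₀ h]
  constructor <;> intro <;> linarith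

theorem IsBellman.wins₁ [Finite V] {G : MeanPayoffGame V} {p M : ℝ} {h : V → ℝ} {up dn : V → V}
    (hb : IsBellman G.toArena univ (fun v => (G.weight v : ℝ)) p M h up dn) (hp : 0 ≤ p)
    {B : Player → ℝ} (hB : IsBudget B) (hlt : p < ratio B) (tie : TieRule V) (v : V) :
    G.toArena.Wins₁ tie (payoffAtLeast G.weight M) v B := by
  obtain ⟨q, hpq, hq⟩ := exists_between hlt
  obtain ⟨a, ha, has⟩ := exists_scale (fun v => h (up v) - h (dn v)) (sub_pos.2 hpq)
  refine G.toArena.wins₁_of_isRun hB tie (potentialBid q a fun v => h (up v) - h (dn v))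
    (tgt := up) (fun v => (hb v trivial).1) fun τ hτ h0 => ?_
  obtain ⟨K, hK⟩ := hτ.sum_bddBelow (fun _ _ _ _ => trivial) hb hp hpq
    (hq.le.trans hB.ratio_mem.2) ha has (fun _ _ => ⟨rfl, rfl⟩) (n₀ := 0) trivial (by
      rw [h0]
      exact (lt_share_iff hB.2).1 hq)
  exact le_payoff hK

theorem IsBellman.wins₂ [Finite V] {G : MeanPayoffGame V} {p M : ℝ} {h : V → ℝ} {up dn : V → V}
    (hb : IsBellman G.toArena univ (fun v => (G.weight v : ℝ)) p M h up dn) (hp : p ≤ 1)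
    {B : Player → ℝ} (hB : IsBudget B) (hlt : ratio B < p) (tie : TieRule V) (v : V) :
    G.toArena.Wins₂ tie {σ | M < payoff G.weight fun n => (σ n).vertex} v B := by
  obtain ⟨q, hpq, hq⟩ := exists_between (sub_lt_sub_left hlt 1)
  obtain ⟨a, ha, has⟩ := exists_scale (fun v => -h (dn v) - -h (up v)) (sub_pos.2 hpq)
  refine G.toArena.wins₂_of_isRun hB tie (potentialBid q a fun v => -h (dn v) - -h (up v))
    (tgt := dn) (fun v => (hb v trivial).2.1) fun τ hτ h0 => ?_
  obtain ⟨K, hK⟩ := hτ.sum_bddBelow (fun _ _ _ _ => trivial) hb.neg (by linarith) hpq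
    (by linarith [hB.ratio_mem.1]) ha has (fun _ _ => ⟨rfl, rfl⟩) (n₀ := 0) trivial (by
      rw [h0]
      refine (lt_share_iff (add_comm (B .one) _ ▸ hB.2)).1 ?_
      change q < share (B .two) (B .one)
      rwa [share_eq_one_sub_ratio hB.2])
  refine not_lt.2 (payoff_le (K := K) fun n => ?_)
  have := hK n
  have e : ∑ j ∈ Finset.range n, (-(G.weight (τ j).vertex : ℝ) - -M) =
      -∑ j ∈ Finset.range n, ((G.weight (τ j).vertex : ℝ) - M) := by
    rw [← Finset.sum_neg_distrib]
    exact Finset.sum_congr rfl fun _ _ => by ring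
  linarith

theorem IsRun.edge {A : Arena V} {P : Player} {bid : V → ℝ → ℝ → ℝ} {tgt : V → V}
    {τ : ℕ → Config V} (hτ : IsRun A P bid tgt τ) (ht : ∀ v, A.Edge v (tgt v)) (n : ℕ) :
    A.Edge (τ n).vertex (τ (n + 1)).vertex := by
  obtain ⟨_, _, h | h⟩ := hτ.step n
  · exact h.1 ▸ ht _
  · exact h.1

/-- No path has a payoff above the value with probability `1`. -/
theorem IsBellman.wins₂_of_one [Finite V] {G : MeanPayoffGame V} {M : ℝ} {h : V → ℝ}
    {up dn : V → V} (hb : IsBellman G.toArena univ (fun v => (G.weight v : ℝ)) 1 M h up dn)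
    {B : Player → ℝ} (hB : IsBudget B) (tie : TieRule V) (v : V) :
    G.toArena.Wins₂ tie {σ | M < payoff G.weight fun n => (σ n).vertex} v B := by
  have ht : ∀ v, G.Edge v (up v) := fun v => (hb v trivial).1
  refine G.toArena.wins₂_of_isRun hB tie (fun _ _ _ => 0) ht fun τ hτ _ => ?_
  obtain ⟨H, hH0, hH⟩ := exists_abs_le_of_finite h
  have hsum : ∀ n, ∑ j ∈ Finset.range n, ((G.weight (τ j).vertex : ℝ) - M) ≤
      h (τ 0).vertex - h (τ n).vertex := by
    intro n
    induction n with
    | zero => simp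
    | succ n ih =>
      obtain ⟨-, -, b3, b4⟩ := hb (τ n).vertex trivial
      have := (b3 _ (hτ.edge ht n)).2
      rw [Finset.sum_range_succ]
      linarith
  refine not_lt.2 (payoff_le (K := 2 * H) fun n => ?_)
  linarith [hsum n, (abs_le.1 (hH (τ 0).vertex)).2, (abs_le.1 (hH (τ n).vertex)).1]

/-- Max guarantees M(p) for every p ≤ r with p < 1. For p > r, Min holds him to M(p) at a ratio
between r and p. Continuity closes the gaps; at r = 1 no such p exists, and the upper bound holds
for every path. -/
theorem MeanPayoffGame.value_eq [Finite V] [Nonempty V] (G : MeanPayoffGame V) {M : ℝ → ℝ}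
    (hcont : ContinuousOn M (Icc 0 1))
    (hM : ∀ p ∈ Icc (0 : ℝ) 1, ∃ h up dn,
      IsBellman G.toArena univ (fun v => (G.weight v : ℝ)) p (M p) h up dn)
    (tie : TieRule V) {r : ℝ} (hr : r ∈ Icc (0 : ℝ) 1) : G.value tie r = M r := by
  have hval : ∀ v, G.valueAt tie r v = M r := by
    intro v
    set C := {c : ℝ | ∀ B, IsBudget B → (r < ratio B ∨ ratio B = 1) →
      G.toArena.Wins₁ tie (payoffAtLeast G.weight c) v B} with hC
    have hmem : ∀ p ∈ Icc (0 : ℝ) 1, p ≤ r → p < 1 → M p ∈ C := by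
      intro p hp hpr hp1 B hB hrB
      obtain ⟨h, up, dn, hb⟩ := hM p hp
      exact hb.wins₁ hp.1 hB (by rcases hrB with hrB | hrB <;> linarith) tie v
    have hle : ∀ c M' B, G.toArena.Wins₁ tie (payoffAtLeast G.weight c) v B →
        G.toArena.Wins₂ tie {σ | M' < payoff G.weight fun n => (σ n).vertex} v B → c ≤ M' := by
      rintro c M' B ⟨f, hf, hf'⟩ ⟨g, hg, hg'⟩
      exact (hf' g hg).trans (not_lt.1 (hg' f hf))
    refine IsLUB.csSup_eq (s := C) ⟨fun c hc => ?_, fun b hb => ?_⟩ 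
      ⟨M 0, hmem 0 ⟨le_rfl, zero_le_one⟩ hr.1 zero_lt_one⟩
    · rcases hr.2.lt_or_eq with hr1 | rfl
      · have htend : Tendsto M (nhdsWithin r (Ioc r 1)) (nhds (M r)) :=
          (hcont r hr).mono_left (nhdsWithin_mono _ fun p hp => ⟨hr.1.trans hp.1.le, hp.2⟩)
        have : (nhdsWithin r (Ioc r 1)).NeBot := by
          rw [nhdsWithin_Ioc_eq_nhdsGT hr1]
          infer_instance
        refine ge_of_tendsto htend (eventually_nhdsWithin_of_forall fun p hp => ?_)
        obtain ⟨h, up, dn, hbell⟩ := hM p ⟨hr.1.trans hp.1.le, hp.2⟩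
        have hs : IsBudget (unitBudget ((r + p) / 2)) :=
          isBudget_unitBudget ⟨by linarith [hr.1, hp.1], by linarith [hp.2]⟩
        have hlt : ratio (unitBudget ((r + p) / 2)) < p := by
          rw [ratio_unitBudget]; linarith [hp.1]
        exact hle c _ _ (hc _ hs (.inl (by rw [ratio_unitBudget]; linarith [hp.1])))
          (hbell.wins₂ hp.2 hs hlt tie v)
      · obtain ⟨h, up, dn, hbell⟩ := hM 1 hr
        have hs : IsBudget (unitBudget 1) := isBudget_unitBudget hr
        exact hle c _ _ (hc _ hs (.inr (ratio_unitBudget 1))) (hbell.wins₂_of_one hs tie v)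
    · rcases hr.2.lt_or_eq with hr1 | rfl
      · exact hb (hmem r hr le_rfl hr1)
      · have htend : Tendsto M (nhdsWithin 1 (Ico 0 1)) (nhds (M 1)) :=
          (hcont 1 hr).mono_left (nhdsWithin_mono _ Ico_subset_Icc_self)
        have : (nhdsWithin (1 : ℝ) (Ico 0 1)).NeBot := by
          rw [nhdsWithin_Ico_eq_nhdsLT zero_lt_one]
          infer_instance
        exact le_of_tendsto htend (eventually_nhdsWithin_of_forall fun p hp =>
          hb (hmem p ⟨hp.1, hp.2.le⟩ hp.2.le hp.2))
  simp only [value, hval, ciInf_const]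

/-- At ratio 1 the value may be negative, which does no harm because no share exceeds 1. -/
theorem MeanPayoffGame.sccRatio_spec [Finite V] [Nonempty V] (G : MeanPayoffGame V) {M : ℝ → ℝ}
    (hmono : MonotoneOn M (Icc 0 1)) (hcont : ContinuousOn M (Icc 0 1))
    (hM : ∀ p ∈ Icc (0 : ℝ) 1, ∃ h up dn,
      IsBellman G.toArena univ (fun v => (G.weight v : ℝ)) p (M p) h up dn)
    (tie : TieRule V) :
    G.sccRatio tie ∈ Icc (0 : ℝ) 1 ∧ (G.sccRatio tie < 1 → 0 ≤ M (G.sccRatio tie)) ∧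
      ∀ r, 0 ≤ r → r < G.sccRatio tie → M r < 0 := by
  have hv : ∀ r ∈ Icc (0 : ℝ) 1, G.value tie r = M r := fun r hr => G.value_eq hcont hM tie hr
  have h0 : (0 : ℝ) ∈ Icc (0 : ℝ) 1 := ⟨le_rfl, zero_le_one⟩
  have h1 : (1 : ℝ) ∈ Icc (0 : ℝ) 1 := ⟨zero_le_one, le_rfl⟩
  rw [sccRatio]
  split_ifs with hz hpos
  · have hset : {r | r ∈ Icc (0 : ℝ) 1 ∧ G.value tie r = 0} = Icc 0 1 ∩ M ⁻¹' {0} := by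
      ext r
      exact and_congr_right fun hr => by simp [hv r hr]
    rw [hset]
    have hcl : IsClosed (Icc (0 : ℝ) 1 ∩ M ⁻¹' {0}) :=
      hcont.preimage_isClosed_of_isClosed isClosed_Icc isClosed_singleton
    have hbdd : BddBelow (Icc (0 : ℝ) 1 ∩ M ⁻¹' {0}) := ⟨0, fun r hr => hr.1.1⟩
    obtain ⟨r, hr, hr0⟩ := hz
    have hmem := hcl.csInf_mem ⟨r, hr, by simpa [hv r hr] using hr0⟩ hbdd
    refine ⟨hmem.1, fun _ => (show M _ = 0 from hmem.2).ge, fun r' hr0' hr' => ?_⟩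
    have hr1 : r' ∈ Icc (0 : ℝ) 1 := ⟨hr0', hr'.le.trans hmem.1.2⟩
    refine lt_of_le_of_ne ((hmono hr1 hmem.1 hr'.le).trans (show M _ = 0 from hmem.2).le)
      fun he => ?_
    exact absurd (csInf_le hbdd ⟨hr1, he⟩) (not_le.2 hr')
  · exact ⟨h0, fun _ => hv 0 h0 ▸ (hpos 0 h0).le, fun r hr hr' => absurd hr' (not_lt.2 hr)⟩
  · refine ⟨h1, fun h => absurd h (lt_irrefl _), fun r hr0 hr1 => ?_⟩
    push Not at hpos hz
    obtain ⟨s, hs, hs0⟩ := hpos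
    have hr : r ∈ Icc (0 : ℝ) 1 := ⟨hr0, hr1.le⟩
    by_contra! hr'
    rw [hv s hs] at hs0
    -- A non-positive and a non-negative value would enclose a zero, which this case excludes.
    obtain ⟨z, hz1, hz2⟩ := isPreconnected_Icc.intermediate_value hs hr hcont ⟨hs0, hr'⟩
    exact hz z hz1 ((hv z hz1).trans hz2)

/-! Bottom strongly-connected components and contraction. -/

theorem Arena.IsBSCC.mem_of_reflTransGen {A : Arena V} {S : Set V} (hS : A.IsBSCC S) {v u : V}
    (h : Relation.ReflTransGen A.Edge v u) (hv : v ∈ S) : u ∈ S := by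
  induction h with
  | refl => exact hv
  | tail _ hbc ih => exact hS.2.1 _ ih _ hbc

theorem Arena.IsBSCC.subset {A : Arena V} {S T : Set V} (hS : A.IsBSCC S) (hT : A.IsBSCC T)
    {v : V} (hvS : v ∈ S) (hvT : v ∈ T) : S ⊆ T := fun u hu =>
  hT.mem_of_reflTransGen (hS.2.2 v hvS u hu) hvT

theorem Arena.BSCC.eq_of_mem {A : Arena V} {S T : A.BSCC} {v : V} (hvS : v ∈ S.1)
    (hvT : v ∈ T.1) : S = T :=
  Subtype.ext ((S.2.subset T.2 hvS hvT).antisymm (T.2.subset S.2 hvT hvS))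

theorem Arena.contract_of_mem (A : Arena V) (S : A.BSCC) {v : V} (hv : v ∈ S.1) :
    A.contract v = .inr S := by
  have h : ∃ S, A.IsBSCC S ∧ v ∈ S := ⟨S.1, S.2, hv⟩
  rw [contract, dif_pos h]
  exact congrArg Sum.inr (BSCC.eq_of_mem (S := ⟨h.choose, h.choose_spec.1⟩) h.choose_spec.2 hv)

theorem Arena.contract_of_not_mem (A : Arena V) {v : V} (h : ¬ ∃ S, A.IsBSCC S ∧ v ∈ S) :
    A.contract v = .inl ⟨v, h⟩ :=
  dif_neg h

theorem Arena.contract_surjective (A : Arena V) : Function.Surjective A.contract := by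
  rintro (⟨v, hv⟩ | S)
  · exact ⟨v, A.contract_of_not_mem hv⟩
  · obtain ⟨v, hv⟩ := S.2.1
    exact ⟨v, A.contract_of_mem S hv⟩

/-- The vertices in bottom strongly-connected components. -/
def Arena.bottom (A : Arena V) : Set V := {v | ∃ S, A.IsBSCC S ∧ v ∈ S}

/-- Among the vertices reachable from v, one whose own reachable set is smallest has a bottom
component as that set. -/
theorem Arena.exists_reachable_bottom [Finite V] (A : Arena V) (v : V) :
    ∃ u ∈ A.bottom, Relation.ReflTransGen A.Edge v u := by
  let R : V → Set V := fun u => {x | Relation.ReflTransGen A.Edge u x}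
  obtain ⟨u, hu, hmin⟩ := Set.exists_min_image (R v) (fun u => (R u).ncard) (Set.toFinite _)
    ⟨v, .refl⟩
  refine ⟨u, ⟨R u, ⟨⟨u, .refl⟩, fun a ha b hab => ha.tail hab, fun a ha b hb => ?_⟩, .refl⟩, hu⟩
  have hsub : R a ⊆ R u := fun x hx => ha.trans hx
  have : R a = R u := Set.eq_of_subset_of_ncard_le hsub (hmin a (hu.trans ha))
  exact (this ▸ hb : b ∈ R a)

theorem Arena.contracted_edge {A : Arena V} {v u : V} (hv : v ∉ A.bottom) (h : A.Edge v u) :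
    A.contracted.Edge (A.contract v) (A.contract u) := by
  rw [A.contract_of_not_mem hv]
  exact ⟨u, h, rfl⟩

theorem Arena.contracted_reflTransGen {A : Arena V} {v u : V}
    (h : Relation.ReflTransGen A.Edge v u) :
    Relation.ReflTransGen A.contracted.Edge (A.contract v) (A.contract u) := by
  induction h with
  | refl => exact .refl
  | @tail a b _ hab ih =>
    by_cases ha : a ∈ A.bottom
    · obtain ⟨S, hS, haS⟩ := ha
      rw [A.contract_of_mem ⟨S, hS⟩ haS] at ih
      rwa [A.contract_of_mem ⟨S, hS⟩ (hS.2.1 a haS b hab)]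
    · exact ih.tail (contracted_edge ha hab)

theorem Arena.exists_reachable_inr [Finite V] (A : Arena V) (x : A.Contracted) :
    ∃ y ∈ range Sum.inr, Relation.ReflTransGen A.contracted.Edge x y := by
  obtain ⟨v, rfl⟩ := A.contract_surjective x
  obtain ⟨u, ⟨S, hS, huS⟩, hu⟩ := A.exists_reachable_bottom v
  exact ⟨A.contract u, ⟨⟨S, hS⟩, (A.contract_of_mem _ huS).symm⟩, contracted_reflTransGen hu⟩

/-- Outside the components, the edges of the contracted graph are exactly the images of edges, so
extremal neighbors lift. -/
theorem IsThresholdEq.pullback {A : Arena V} {T : A.Contracted → ℝ}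
    {up dn : A.Contracted → A.Contracted}
    (hT : IsThresholdEq A.contracted (range Sum.inr) T up dn) :
    ∃ up' dn', IsThresholdEq A A.bottom (fun v => T (A.contract v)) up' dn' := by
  have h : ∀ v, ∃ a b, v ∉ A.bottom → A.Edge v a ∧ A.Edge v b ∧
      A.contract a = up (A.contract v) ∧ A.contract b = dn (A.contract v) := by
    intro v
    by_cases hv : v ∈ A.bottom
    · exact ⟨v, v, fun h => absurd hv h⟩
    · obtain ⟨h1, h2, -⟩ := hT.2 (A.contract v) (by simp [A.contract_of_not_mem hv])
      have e := A.contract_of_not_mem hv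
      rw [e] at h1 h2
      obtain ⟨a, ha, ha'⟩ := h1
      obtain ⟨b, hb, hb'⟩ := h2
      exact ⟨a, b, fun _ => ⟨ha, hb, by rw [e, ha'], by rw [e, hb']⟩⟩
  choose a b hab using h
  refine ⟨a, b, fun v => hT.1 _, fun v hv => ?_⟩
  obtain ⟨ha, hb, ha', hb'⟩ := hab v hv
  obtain ⟨-, -, h3, h4⟩ := hT.2 (A.contract v) (by simp [A.contract_of_not_mem hv])
  beta_reduce
  rw [ha', hb']
  exact ⟨ha, hb, fun u hu => h3 _ (Arena.contracted_edge hv hu), h4⟩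

/-! The games on the components. -/

theorem MeanPayoffGame.restrict_reflTransGen (G : MeanPayoffGame V) (S : G.toArena.BSCC)
    (v u : S.1) : Relation.ReflTransGen (G.restrict S).Edge v u := by
  have key : ∀ a b, Relation.ReflTransGen G.Edge a b → ∀ (ha : a ∈ S.1) (hb : b ∈ S.1),
      Relation.ReflTransGen (G.restrict S).Edge ⟨a, ha⟩ ⟨b, hb⟩ := by
    intro a b h ha
    induction h with
    | refl => exact fun _ => .refl
    | tail hab hbc ih =>
      exact fun _ => (ih (S.2.mem_of_reflTransGen hab ha)).tail hbc
  exact key v u (S.2.2.2 v v.2 u u.2) v.2 u.2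

theorem IsBellman.extend {G : MeanPayoffGame V} {S : G.toArena.BSCC} {p M : ℝ} {h : S.1 → ℝ}
    {up dn : S.1 → S.1}
    (hb : IsBellman (G.restrict S).toArena univ (fun v => ((G.restrict S).weight v : ℝ)) p M h
      up dn) :
    ∃ h' up' dn', IsBellman G.toArena S.1 (fun v => (G.weight v : ℝ)) p M h' up' dn' := by
  classical
  refine ⟨fun v => if hv : v ∈ S.1 then h ⟨v, hv⟩ else 0,
    fun v => if hv : v ∈ S.1 then up ⟨v, hv⟩ else v,
    fun v => if hv : v ∈ S.1 then dn ⟨v, hv⟩ else v, fun v hv => ?_⟩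
  obtain ⟨h1, h2, h3, h4⟩ := hb ⟨v, hv⟩ trivial
  simp only [hv, dif_pos, Subtype.coe_prop, Subtype.coe_eta]
  refine ⟨h1, h2, fun u hu => ?_, h4⟩
  have huS := S.2.2.1 v hv u hu
  simp only [huS, dif_pos]
  exact h3 ⟨u, huS⟩ hu

theorem MeanPayoffGame.sccRatio_restrict_spec [Finite V] (G : MeanPayoffGame V)
    (S : G.toArena.BSCC) (tie : TieRule S.1) :
    (G.restrict S).sccRatio tie ∈ Icc (0 : ℝ) 1 ∧
      ((G.restrict S).sccRatio tie < 1 → ∃ M h up dn, 0 ≤ M ∧ IsBellman G.toArena S.1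
        (fun v => (G.weight v : ℝ)) ((G.restrict S).sccRatio tie) M h up dn) ∧
      ∀ r, 0 ≤ r → r < (G.restrict S).sccRatio tie → ∃ M h up dn, M < 0 ∧
        IsBellman G.toArena S.1 (fun v => (G.weight v : ℝ)) r M h up dn := by
  have : Nonempty S.1 := S.2.1.to_subtype
  obtain ⟨M, hmono, hcont, hM⟩ := exists_randomTurnValue (G.restrict S).toArena
    (G.restrict_reflTransGen S) fun v => ((G.restrict S).weight v : ℝ)
  obtain ⟨h1, h2, h3⟩ := (G.restrict S).sccRatio_spec hmono hcont hM tie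
  refine ⟨h1, fun hlt => ?_, fun r hr0 hr => ?_⟩
  · obtain ⟨h, up, dn, hb⟩ := hM _ h1
    obtain ⟨h', up', dn', hb'⟩ := hb.extend
    exact ⟨_, h', up', dn', h2 hlt, hb'⟩
  · obtain ⟨h, up, dn, hb⟩ := hM r ⟨hr0, hr.le.trans h1.2⟩
    obtain ⟨h', up', dn', hb'⟩ := hb.extend
    exact ⟨_, h', up', dn', h3 r hr0 hr, hb'⟩

/-! Reaching a component with a sufficient ratio and winning there. -/

theorem exists_componentStrategy [Finite V] {A : Arena V} {w : V → ℝ} {T : V → ℝ} {ε : ℝ}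
    {good : ℝ → Prop} (S : A.BSCC) {ρ : ℝ} (hρ : ∀ v ∈ S.1, T v = ρ) (hε : 0 < ε)
    (hgood : ρ < 1 → ∃ p M h up dn, 0 ≤ p ∧ p < 1 ∧ p < ρ + ε / 2 ∧ good M ∧
      IsBellman A S.1 w p M h up dn) :
    ∃ (bidS : V → ℝ → ℝ → ℝ) (tgtS : V → V), (∀ v ∈ S.1, A.Edge v (tgtS v)) ∧
      ∀ P bid tgt τ, IsRun A P bid tgt τ → (∀ v ∈ S.1, bid v = bidS v ∧ tgt v = tgtS v) →
        ∀ n, (τ n).vertex ∈ S.1 → 0 < (τ n).budget P + (τ n).budget P.other →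
          T (τ n).vertex + ε / 2 ≤ share ((τ n).budget P) ((τ n).budget P.other) →
          ∃ M K, good M ∧ ∀ m, -K ≤ ∑ j ∈ Finset.range m, (w (τ j).vertex - M) := by
  by_cases h1 : ρ < 1
  · obtain ⟨p, M, h, up, dn, hp0, hp1, hpρ, hM, hb⟩ := hgood h1
    obtain ⟨q, hpq, hq⟩ := exists_between (lt_min hp1 hpρ)
    obtain ⟨a, ha, has⟩ := exists_scale (fun v => h (up v) - h (dn v)) (sub_pos.2 hpq)
    refine ⟨potentialBid q a fun v => h (up v) - h (dn v), up, fun v hv => (hb v hv).1, ?_⟩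
    intro P bid tgt τ hτ hbid n hn hpos hs
    rw [hρ _ hn] at hs
    obtain ⟨K, hK⟩ := hτ.sum_bddBelow S.2.2.1 hb hp0 hpq (hq.le.trans (min_le_left _ _)) ha has
      hbid hn ((lt_share_iff hpos).1 (hq.trans_le ((min_le_right _ _).trans hs)))
    exact ⟨M, K, hM, hK⟩
  -- Here entry would need a share of at least 1 + ε/2, so any moves do.
  · choose e he using A.exists_edge
    refine ⟨fun _ _ _ => 0, e, fun v _ => he v, ?_⟩
    intro P bid tgt τ hτ _ n hn hpos hs
    rw [hρ _ hn] at hs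
    have := share_le_one (hτ.nonneg n P.other) hpos
    linarith

/-- Reachability bids outside the components, potential bids inside. The predicate `good` covers
both players: Max needs 0 ≤ M, Min needs 0 < M for the negated weights. -/
theorem exists_combinedStrategy [Finite V] {A : Arena V} {w : V → ℝ} {T : V → ℝ}
    {up dn : V → V} (hT : IsThresholdEq A A.bottom T up dn) {ε : ℝ} (hε : 0 < ε)
    {good : ℝ → Prop} {ρ : A.BSCC → ℝ} (hρ : ∀ S : A.BSCC, ∀ v ∈ S.1, T v = ρ S)
    (hgood : ∀ S : A.BSCC, ρ S < 1 → ∃ p M h up dn, 0 ≤ p ∧ p < 1 ∧ p < ρ S + ε / 2 ∧ good M ∧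
      IsBellman A S.1 w p M h up dn) :
    ∃ (bid : V → ℝ → ℝ → ℝ) (tgt : V → V), (∀ v, A.Edge v (tgt v)) ∧
      ∀ P τ, IsRun A P bid tgt τ → 0 < (τ 0).budget P + (τ 0).budget P.other →
        T (τ 0).vertex + ε ≤ share ((τ 0).budget P) ((τ 0).budget P.other) →
        ∃ M K, good M ∧ ∀ m, -K ≤ ∑ j ∈ Finset.range m, (w (τ j).vertex - M) := by
  classical
  obtain ⟨U, next, hU, hUT⟩ := hT.exists_strictBound A.exists_reachable_bottom hε
  choose bidS tgtS hedge hwin using fun S => exists_componentStrategy S (hρ S) hε (hgood S)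
  let comp : V → Option A.BSCC := fun v => if h : ∃ S : A.BSCC, v ∈ S.1 then some h.choose else none
  have hcomp : ∀ S : A.BSCC, ∀ v ∈ S.1, comp v = some S := by
    intro S v hv
    have h : ∃ S : A.BSCC, v ∈ S.1 := ⟨S, hv⟩
    simp only [comp, dif_pos h]
    exact congrArg some (Arena.BSCC.eq_of_mem h.choose_spec hv)
  have hcomp' : ∀ v ∉ A.bottom, comp v = none := by
    intro v hv
    exact dif_neg fun ⟨S, hS⟩ => hv ⟨S.1, S.2, hS⟩
  refine ⟨fun v => (comp v).elim (reachBid U next v) fun S => bidS S v,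
    fun v => (comp v).elim (next v) fun S => tgtS S v, fun v => ?_, fun P τ hτ hpos hs => ?_⟩
  · beta_reduce
    by_cases hv : v ∈ A.bottom
    · obtain ⟨S, hS, hvS⟩ := hv
      rw [hcomp ⟨S, hS⟩ v hvS]
      exact hedge ⟨S, hS⟩ v hvS
    · rw [hcomp' v hv]
      exact (hU.2 v hv).1
  · obtain ⟨n, ⟨S, hS, hn⟩, -, hpos', hs'⟩ := hτ.exists_hit hU
      (fun v hv => by rw [hcomp' v hv]; exact ⟨rfl, rfl⟩) hpos ((hUT _).2.trans_le hs)
    exact hwin ⟨S, hS⟩ P _ _ τ hτ (fun v hv => by rw [hcomp ⟨S, hS⟩ v hv]; exact ⟨rfl, rfl⟩) n hn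
      hpos' ((hUT _).1.trans hs'.le)

/-- Solutions of the threshold equations are thresholds of the mean-payoff game if they agree on
the components with the ratios of the components. -/
theorem IsThresholdEq.isThreshold [Finite V] {G : MeanPayoffGame V}
    {tieS : ∀ S : G.toArena.BSCC, TieRule S.1} {T : V → ℝ} {up dn : V → V}
    (hT : IsThresholdEq G.toArena G.toArena.bottom T up dn)
    (hρ : ∀ S : G.toArena.BSCC, ∀ v ∈ S.1, T v = (G.restrict S).sccRatio (tieS S))
    (tie : TieRule V) (v : V) : G.IsThreshold tie v (T v) := by
  refine ⟨hT.1 v, fun B hB => ⟨fun hlt => ?_, fun hlt => ?_⟩⟩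
  · have hε := sub_pos.2 hlt
    obtain ⟨bid, tgt, htgt, hwin⟩ := exists_combinedStrategy
      (w := fun v => (G.weight v : ℝ)) (good := fun M => 0 ≤ M) hT hε hρ fun S hS => by
        obtain ⟨h1, h2, -⟩ := G.sccRatio_restrict_spec S (tieS S)
        obtain ⟨M, h, up, dn, hM, hb⟩ := h2 hS
        exact ⟨_, M, h, up, dn, h1.1, hS, by linarith, hM, hb⟩
    refine Arena.wins₁_of_isRun hB tie bid htgt fun τ hτ h0 => ?_
    obtain ⟨M, K, hM, hK⟩ := hwin .one τ hτ (by rw [h0]; exact hB.2) (by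
      rw [h0]
      change _ ≤ ratio B
      linarith)
    exact hM.trans (le_payoff hK)
  · have hε := sub_pos.2 hlt
    obtain ⟨bid, tgt, htgt, hwin⟩ := exists_combinedStrategy
      (w := fun v => -(G.weight v : ℝ)) (good := fun M => 0 < M)
      (ρ := fun S => 1 - (G.restrict S).sccRatio (tieS S)) hT.one_sub hε
      (fun S v hv => by rw [hρ S v hv]) fun S hS => by
        obtain ⟨h1, -, h3⟩ := G.sccRatio_restrict_spec S (tieS S)
        set ρ := (G.restrict S).sccRatio (tieS S)
        have hρ0 : 0 < ρ := by linarith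
        -- Min needs a strictly negative value, hence a probability r below ρ; keeping r above ρ -
        -- ε/2 lets his share at entry suffice.
        obtain ⟨r, hr, hr'⟩ := exists_between (max_lt hρ0 (sub_lt_self ρ (half_pos hε)))
        rw [max_lt_iff] at hr
        obtain ⟨M, h, up, dn, hM, hb⟩ := h3 r hr.1.le hr'
        exact ⟨1 - r, -M, _, _, _, by linarith [h1.2], by linarith [hr.1], by linarith [hr.2],
          by linarith, hb.neg⟩
    refine Arena.wins₂_of_isRun hB tie bid htgt fun τ hτ h0 => ?_
    obtain ⟨M, K, hM, hK⟩ := hwin .two τ hτ (by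
      rw [h0]
      exact add_comm (B .one) _ ▸ hB.2) (by
      rw [h0]
      change _ ≤ share (B .two) (B .one)
      rw [share_eq_one_sub_ratio hB.2]
      linarith)
    refine not_le.2 (lt_of_le_of_lt (payoff_le (M := -M) (K := K) fun n => ?_) (neg_neg_of_pos hM))
    have := hK n
    have e : ∑ j ∈ Finset.range n, (-(G.weight (τ j).vertex : ℝ) - M) =
        -∑ j ∈ Finset.range n, ((G.weight (τ j).vertex : ℝ) - -M) := by
      rw [← Finset.sum_neg_distrib]
      exact Finset.sum_congr rfl fun _ _ => by ring
    linarith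

theorem exists_reachStrategy [Finite V] (A : Arena V) {T : A.Contracted → ℝ}
    {up dn : A.Contracted → A.Contracted}
    (hT : IsThresholdEq A.contracted (range Sum.inr) T up dn) {ε : ℝ} (hε : 0 < ε) :
    ∃ (bid : A.Contracted → ℝ → ℝ → ℝ) (tgt : A.Contracted → A.Contracted),
      (∀ x, A.contracted.Edge x (tgt x)) ∧
      ∀ P τ, IsRun A.contracted P bid tgt τ → 0 < (τ 0).budget P + (τ 0).budget P.other →
        T (τ 0).vertex + ε ≤ share ((τ 0).budget P) ((τ 0).budget P.other) →
        ∃ n S, (τ n).vertex = .inr S ∧ (∀ m < n, ∀ S', (τ m).vertex ≠ .inr S') ∧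
          0 < (τ n).budget P + (τ n).budget P.other ∧
          T (.inr S) < share ((τ n).budget P) ((τ n).budget P.other) := by
  classical
  obtain ⟨U, next, hU, hUT⟩ := hT.exists_strictBound A.exists_reachable_inr hε
  refine ⟨reachBid U next, fun x => if x ∈ range Sum.inr then x else next x, fun x => ?_,
    fun P τ hτ hpos hs => ?_⟩
  · beta_reduce
    by_cases hx : x ∈ range Sum.inr
    · rw [if_pos hx]
      obtain ⟨S, rfl⟩ := hx
      rfl
    · rw [if_neg hx]
      exact (hU.2 x hx).1
  · obtain ⟨n, ⟨S, hS⟩, hfirst, hpos', hs'⟩ := hτ.exists_hit hU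
      (fun x hx => ⟨rfl, if_neg hx⟩) hpos ((hUT _).2.trans_le hs)
    refine ⟨n, S, hS.symm, fun m hm S' h => hfirst m hm ⟨S', h.symm⟩, hpos', ?_⟩
    rw [← hS] at hs'
    linarith [(hUT (Sum.inr S)).1]

/-- Solutions of the threshold equations are thresholds of the generalized reachability game. -/
theorem IsThresholdEq.isThreshold_reachWithRatio [Finite V] {A : Arena V} {T : A.Contracted → ℝ}
    {up dn : A.Contracted → A.Contracted}
    (hT : IsThresholdEq A.contracted (range Sum.inr) T up dn) {ρ : A.BSCC → ℝ}
    (hρ : ∀ S, T (.inr S) = ρ S) (tie : TieRule A.Contracted) (x : A.Contracted) :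
    A.contracted.IsThreshold tie (A.reachWithRatio ρ) x (T x) := by
  refine ⟨hT.1 x, fun B hB => ⟨fun hlt => ?_, fun hlt => ?_⟩⟩
  · obtain ⟨bid, tgt, htgt, hwin⟩ := exists_reachStrategy A hT (sub_pos.2 hlt)
    refine Arena.wins₁_of_isRun hB tie bid htgt fun τ hτ h0 => ?_
    obtain ⟨n, S, hn, hfirst, -, hs⟩ := hwin .one τ hτ (by rw [h0]; exact hB.2) (by
      rw [h0]
      change _ ≤ ratio B
      linarith)
    exact ⟨n, S, hn, hfirst, (hρ S ▸ hs).le⟩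
  · obtain ⟨bid, tgt, htgt, hwin⟩ := exists_reachStrategy A hT.one_sub (sub_pos.2 hlt)
    refine Arena.wins₂_of_isRun hB tie bid htgt fun τ hτ h0 => ?_
    obtain ⟨n, S, hn, hfirst, hpos, hs⟩ := hwin .two τ hτ (by
      rw [h0]
      exact add_comm (B .one) _ ▸ hB.2) (by
      rw [h0]
      change _ ≤ share (B .two) (B .one)
      rw [share_eq_one_sub_ratio hB.2]
      linarith)
    -- The first hit is unique, so at that time the ratio would be both at least and below that of
    -- the component.
    rintro ⟨m, S', hm, hfirst', hr⟩
    obtain rfl : n = m := le_antisymm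
      (not_lt.1 fun h => hfirst m h S' hm) (not_lt.1 fun h => hfirst' n h S hn)
    obtain rfl : S = S' := Sum.inr_injective (hn.symm.trans hm)
    change 1 - T (.inr S) < share ((τ n).budget .two) ((τ n).budget .one) at hs
    rw [share_eq_one_sub_ratio (add_comm ((τ n).budget .one) _ ▸ hpos), hρ S] at hs
    linarith

/-- A common threshold of the mean-payoff game and of the generalized reachability game. -/
theorem MeanPayoffGame.exists_common_threshold [Finite V] (G : MeanPayoffGame V) (tie : TieRule V)
    (tieS : ∀ S : G.toArena.BSCC, TieRule S.1) (tie' : TieRule G.toArena.Contracted) (v : V) :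
    ∃ t, G.IsThreshold tie v t ∧ G.IsReachThreshold tieS tie' (G.toArena.contract v) t := by
  obtain ⟨T, up, dn, hT, hTr⟩ := exists_isThresholdEq G.toArena.contracted (range Sum.inr)
    (Sum.elim (fun _ => 0) fun S => (G.restrict S).sccRatio (tieS S)) (by
      rintro _ ⟨S, rfl⟩
      exact (G.sccRatio_restrict_spec S (tieS S)).1)
  have hTS : ∀ S, T (.inr S) = (G.restrict S).sccRatio (tieS S) := fun S => hTr _ ⟨S, rfl⟩
  obtain ⟨up', dn', hT'⟩ := hT.pullback
  exact ⟨T (G.toArena.contract v),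
    hT'.isThreshold (fun S u hu => by rw [G.toArena.contract_of_mem S hu, hTS]) tie v,
    hT.isThreshold_reachWithRatio hTS tie' _⟩

end Poorman

theorem theorem5 {V : Type*} [Finite V] (G : Poorman.MeanPayoffGame V)
    (tie : Poorman.TieRule V)
    (tieS : ∀ S : G.toArena.BSCC, Poorman.TieRule S.1)
    (tie' : Poorman.TieRule G.toArena.Contracted)
    (v : V) :
    (∃ t : ℝ, G.IsThreshold tie v t) ∧
      ∀ t : ℝ, G.IsThreshold tie v t ↔
        G.IsReachThreshold tieS tie' (G.toArena.contract v) t := by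
  obtain ⟨t, h₁, h₂⟩ := G.exists_common_threshold tie tieS tie' v
  refine ⟨⟨t, h₁⟩, fun s => ⟨fun hs => ?_, fun hs => ?_⟩⟩
  · exact Poorman.Arena.IsThreshold.eq h₁ hs ▸ h₂
  · exact Poorman.Arena.IsThreshold.eq h₂ hs ▸ h₁
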